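/- Let $K$ be any field and let $h\ge 2$ be an integer. Put $$a_1=(2h-1)2h,\quad a_2=(2h-1)(2h+1),\quad a_3=2h(2h+1),\quad a_4=2h(2h+1)+2h-1,$$ and let $B_h=\langle a_1,a_2,a_3,a_4\rangle\subseteq\mathbb N$ be the (Bresinsky) monoid they generate. Let $K[B_h]\subseteq K[t]$ be the $K$-subalgebra generated by the monomials $t^s$, $s\in B_h$, let $\mathfrak m=(t^s : s\in B_h\setminus\{0\})$, and let $\operatorname{gr}_{\mathfrak m}K[B_h]=\bigoplus_{i\ge 0}\mathfrak m^i/\mathfrak m^{i+1}$ be the tangent cone. Let $S=K[x_1,x_2,x_3,x_4]$ be the polynomial ring, and regard $K[B_h]$ as an $S$-algebra through $x_i\mapsto t^{a_i}$, regard $\operatorname{gr}_{\mathfrak m}K[B_h]$ as an $S$-algebra through $x_i\mapsto t^{a_i}+\mathfrak m^2\in\mathfrak m/\mathfrak m^2$, and regard $K$ as the $S$-module $S/(x_1,x_2,x_3,x_4)$. For $A\in\{K[B_h],\operatorname{gr}_{\mathfrak m}K[B_h]\}$ and $i\ge0$ let $\beta_i(A)=\dim_K\operatorname{Tor}_i^S(A,K)$,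 which is the rank of the $i$-th module in a minimal (graded) free $S$-resolution of $A$. Then $B_h$ is a numerical semigroup (that is, $\mathbb N\setminus B_h$ is finite) whose minimal generating set consists of the four numbers $a_1,a_2,a_3,a_4$, and both $K[B_h]$ and $\operatorname{gr}_{\mathfrak m}K[B_h]$ have the Betti sequence $$(1,\;4h,\;8h-4,\;4h-3),$$ that is, for both algebras $\beta_0=1$, $\beta_1=4h$, $\beta_2=8h-4$, $\beta_3=4h-3$, and $\beta_i=0$ for all $i\ge4$. -/

import Mathlib

universe u

noncomputable section

/-! ### The associated graded ring `gr_I R = ⨁ I^i / I^(i+1)` of an ideal -/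

section AssociatedGraded

variable {R : Type u} [CommRing R] (I : Ideal R)

/-- The graded piece `I^i / I^(i+1)`. -/
def GradedPiece (i : ℕ) : Type u :=
  ↥(I ^ i) ⧸ Submodule.comap (Submodule.subtype (I ^ i)) (I ^ (i + 1))

namespace GradedPiece

instance (i : ℕ) : AddCommGroup (GradedPiece I i) :=
  inferInstanceAs (AddCommGroup
    (↥(I ^ i) ⧸ Submodule.comap (Submodule.subtype (I ^ i)) (I ^ (i + 1))))

instance (i : ℕ) : Module R (GradedPiece I i) :=
  inferInstanceAs (Module R
    (↥(I ^ i) ⧸ Submodule.comap (Submodule.subtype (I ^ i)) (I ^ (i + 1))))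

/-- The class of an element of `I^i` in `I^i / I^(i+1)`. -/
def mk (i : ℕ) : ↥(I ^ i) →ₗ[R] GradedPiece I i :=
  Submodule.mkQ (Submodule.comap (Submodule.subtype (I ^ i)) (I ^ (i + 1)))

theorem mk_surjective (i : ℕ) : Function.Surjective (mk I i) :=
  Submodule.mkQ_surjective _

theorem mk_eq_zero_iff {i : ℕ} (x : ↥(I ^ i)) : mk I i x = 0 ↔ (x : R) ∈ I ^ (i + 1) := by
  refine (Submodule.Quotient.mk_eq_zero _).trans ?_
  simp

theorem mk_eq_mk_iff {i : ℕ} (x y : ↥(I ^ i)) :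
    mk I i x = mk I i y ↔ (x : R) - y ∈ I ^ (i + 1) := by
  rw [← sub_eq_zero, ← map_sub, mk_eq_zero_iff]
  rfl

/-- Multiplication `I^i × I^j → I^(i+j)` on representatives. -/
def preMul {i j : ℕ} (x : ↥(I ^ i)) (y : ↥(I ^ j)) : ↥(I ^ (i + j)) :=
  ⟨(x : R) * y, by rw [pow_add]; exact Ideal.mul_mem_mul x.2 y.2⟩

/-- Multiplication `I^i/I^(i+1) × I^j/I^(j+1) → I^(i+j)/I^(i+j+1)`, the product of two classes
being the class of the product of any representatives. -/
def mul {i j : ℕ} : GradedPiece I i → GradedPiece I j → GradedPiece I (i + j) :=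
  Quotient.map₂ (preMul I) (by
    intro x x' hx y y' hy
    have hx : (x : R) - x' ∈ I ^ (i + 1) := (mk_eq_mk_iff I x x').1 (Quotient.sound hx)
    have hy : (y : R) - y' ∈ I ^ (j + 1) := (mk_eq_mk_iff I y y').1 (Quotient.sound hy)
    refine Quotient.exact ((mk_eq_mk_iff I _ _).2 ?_)
    have h1 : ((x : R) - x') * y ∈ I ^ (i + j + 1) := by
      rw [show i + j + 1 = (i + 1) + j by ring, pow_add]
      exact Ideal.mul_mem_mul hx y.2
    have h2 : (x' : R) * ((y : R) - y') ∈ I ^ (i + j + 1) := by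
      rw [show i + j + 1 = i + (j + 1) by ring, pow_add]
      exact Ideal.mul_mem_mul x'.2 hy
    have h3 := Ideal.add_mem _ h1 h2
    have h4 : ((x : R) - x') * y + (x' : R) * ((y : R) - y') = (x : R) * y - (x' : R) * y' := by
      ring
    rw [h4] at h3
    exact h3)

theorem mul_mk {i j : ℕ} (x : ↥(I ^ i)) (y : ↥(I ^ j)) :
    mul I (mk I i x) (mk I j y) = mk I (i + j) (preMul I x y) := rfl

theorem mk_congr {i j : ℕ} (h : i = j) (x : ↥(I ^ i)) (y : ↥(I ^ j)) (hxy : (x : R) = y) :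
    GradedMonoid.mk (A := GradedPiece I) i (mk I i x) = GradedMonoid.mk j (mk I j y) := by
  subst h
  rw [Subtype.ext hxy]

/-- The element of `I^0` given by an element of `R`. -/
def zeroRep (r : R) : ↥(I ^ 0) := ⟨r, by simp⟩

instance : GradedMonoid.GMul (GradedPiece I) := ⟨mul I⟩

instance : GradedMonoid.GOne (GradedPiece I) := ⟨mk I 0 (zeroRep I 1)⟩

/-- The multiplication of classes makes the family `I^i / I^(i+1)` a graded commutative ring. -/
instance : DirectSum.GCommRing (GradedPiece I) where
  mul_zero {i j} a := by
    obtain ⟨x, rfl⟩ := mk_surjective I i a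
    rw [← map_zero (mk I j)]
    exact (mul_mk I x 0).trans ((mk_eq_zero_iff I _).2 (by simp [preMul]))
  zero_mul {i j} b := by
    obtain ⟨y, rfl⟩ := mk_surjective I j b
    rw [← map_zero (mk I i)]
    exact (mul_mk I 0 y).trans ((mk_eq_zero_iff I _).2 (by simp [preMul]))
  mul_add {i j} a b c := by
    obtain ⟨x, rfl⟩ := mk_surjective I i a
    obtain ⟨y, rfl⟩ := mk_surjective I j b
    obtain ⟨z, rfl⟩ := mk_surjective I j c
    change mul I _ _ = mul I _ _ + mul I _ _
    rw [← map_add, mul_mk, mul_mk, mul_mk, ← map_add]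
    congr 1
    exact Subtype.ext (mul_add _ _ _)
  add_mul {i j} a b c := by
    obtain ⟨x, rfl⟩ := mk_surjective I i a
    obtain ⟨y, rfl⟩ := mk_surjective I i b
    obtain ⟨z, rfl⟩ := mk_surjective I j c
    change mul I _ _ = mul I _ _ + mul I _ _
    rw [← map_add, mul_mk, mul_mk, mul_mk, ← map_add]
    congr 1
    exact Subtype.ext (add_mul _ _ _)
  one_mul := by
    rintro ⟨i, a⟩
    obtain ⟨x, rfl⟩ := mk_surjective I i a
    exact mk_congr I (zero_add i) (preMul I (zeroRep I 1) x) x (one_mul _)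
  mul_one := by
    rintro ⟨i, a⟩
    obtain ⟨x, rfl⟩ := mk_surjective I i a
    exact mk_congr I (add_zero i) (preMul I x (zeroRep I 1)) x (mul_one _)
  mul_assoc := by
    rintro ⟨i, a⟩ ⟨j, b⟩ ⟨k, c⟩
    obtain ⟨x, rfl⟩ := mk_surjective I i a
    obtain ⟨y, rfl⟩ := mk_surjective I j b
    obtain ⟨z, rfl⟩ := mk_surjective I k c
    exact mk_congr I (add_assoc i j k) (preMul I (preMul I x y) z) (preMul I x (preMul I y z))
      (mul_assoc _ _ _)
  mul_comm := by
    rintro ⟨i, a⟩ ⟨j, b⟩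
    obtain ⟨x, rfl⟩ := mk_surjective I i a
    obtain ⟨y, rfl⟩ := mk_surjective I j b
    exact mk_congr I (add_comm i j) (preMul I x y) (preMul I y x) (mul_comm _ _)
  natCast n := mk I 0 (zeroRep I n)
  natCast_zero := (mk_eq_zero_iff I _).2 (by simp [zeroRep])
  natCast_succ n := by
    change _ = mk I 0 (zeroRep I n) + mk I 0 (zeroRep I 1)
    rw [← map_add]
    congr 1
    exact Subtype.ext (Nat.cast_succ n)
  intCast n := mk I 0 (zeroRep I n)
  intCast_ofNat n := by
    congr 1
    exact Subtype.ext (Int.cast_natCast n)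
  intCast_negSucc_ofNat n := by
    change _ = -mk I 0 (zeroRep I ((n + 1 : ℕ) : R))
    rw [← map_neg]
    congr 1
    exact Subtype.ext (Int.cast_negSucc n)

end GradedPiece

/-- The associated graded ring `gr_I R = ⨁_{i ≥ 0} I^i / I^(i+1)`. -/
abbrev AssociatedGraded : Type u := DirectSum ℕ (GradedPiece I)

namespace AssociatedGraded

/-- The class in `I^i / I^(i+1)` of `x ∈ I^i`, as an element of `gr_I R`. -/
def of (i : ℕ) (x : R) (hx : x ∈ I ^ i) : AssociatedGraded I :=
  DirectSum.of (GradedPiece I) i (GradedPiece.mk I i ⟨x, hx⟩)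

theorem of_mul_of (i j : ℕ) (x y : R) (hx : x ∈ I ^ i) (hy : y ∈ I ^ j) :
    of I i x hx * of I j y hy =
      of I (i + j) (x * y) (by rw [pow_add]; exact Ideal.mul_mem_mul hx hy) :=
  DirectSum.of_mul_of _ _

/-- The structure map `R → R / I = I^0 / I^1 ⊆ gr_I R`. -/
def ofZero : R →+* AssociatedGraded I where
  toFun r := of I 0 r (by simp)
  map_one' := rfl
  map_mul' r s := (of_mul_of I 0 0 r s _ _).symm
  map_zero' := by
    have : GradedPiece.mk I 0 ⟨0, by simp⟩ = 0 := (GradedPiece.mk_eq_zero_iff I _).2 (by simp)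
    rw [of, this, map_zero]
  map_add' r s := by
    simp only [of]
    rw [← map_add, ← map_add]
    rfl

end AssociatedGraded

end AssociatedGraded

/-! ### Betti numbers -/

section Betti

open CategoryTheory

variable (K : Type u) [Field K] {n : ℕ}

/-- The `i`-th Betti number `dim_K Tor_i^S(A, K)` over `S = K[x_1, …, x_n]` of a ring `A` that is an
`S`-module through a ring homomorphism `φ : S → A`. Here `K = S / (x_1, …, x_n)` is an `S`-module
through the evaluation `S → K` at the origin. -/
def bettiNumber {A : Type u} [CommRing A] (φ : MvPolynomial (Fin n) K →+* A) (i : ℕ) :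
    Cardinal.{u} :=
  Module.rank K ((ModuleCat.restrictScalars (MvPolynomial.C (σ := Fin n) (R := K))).obj
    (((Tor (ModuleCat.{u} (MvPolynomial (Fin n) K)) i).obj
      ((ModuleCat.restrictScalars φ).obj (ModuleCat.of A A))).obj
      ((ModuleCat.restrictScalars (MvPolynomial.constantCoeff (σ := Fin n) (R := K))).obj
        (ModuleCat.of K K))))

/-- The Betti sequence of `A` over `S` is the list `l`: the `i`-th Betti number is the `i`-th entry
of `l` for each `i` below the length of `l`, and is zero beyond. -/
def HasBettiSequence {A : Type u} [CommRing A] (φ : MvPolynomial (Fin n) K →+* A) (l : List ℕ) :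
    Prop :=
  ∀ i : ℕ, bettiNumber K φ i = ((l.getD i 0 : ℕ) : Cardinal.{u})

end Betti

/-! ### Numerical semigroups, their semigroup rings and tangent cones -/

section Semigroup

/-- A submonoid of `ℕ` is a numerical semigroup if its complement is finite. -/
def IsNumericalSemigroup (H : AddSubmonoid ℕ) : Prop := ((H : Set ℕ)ᶜ).Finite

variable (K : Type u) [Field K]

/-- The semigroup ring `K[H]`, the subalgebra of `K[t]` generated by the monomials `t^s`, `s ∈ H`. -/
abbrev SemigroupRing (H : AddSubmonoid ℕ) : Type u :=
  ↥(Algebra.adjoin K {f : Polynomial K | ∃ s ∈ H, f = Polynomial.X ^ s})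

/-- The monomial `t^s` of `K[H]`, for `s ∈ H`. -/
def SemigroupRing.monomial {H : AddSubmonoid ℕ} (s : ℕ) (hs : s ∈ H) : SemigroupRing K H :=
  ⟨Polynomial.X ^ s, Algebra.subset_adjoin ⟨s, hs, rfl⟩⟩

/-- The maximal ideal `𝔪 = (t^s : s ∈ H, s ≠ 0)` of `K[H]`. -/
def SemigroupRing.maxIdeal (H : AddSubmonoid ℕ) : Ideal (SemigroupRing K H) :=
  Ideal.span {f | ∃ (s : ℕ) (hs : s ∈ H), s ≠ 0 ∧ f = SemigroupRing.monomial K s hs}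

/-- The tangent cone `gr_𝔪 K[H]`. -/
abbrev TangentCone (H : AddSubmonoid ℕ) : Type u :=
  AssociatedGraded (SemigroupRing.maxIdeal K H)

variable {n : ℕ} (a : Fin n → ℕ)

/-- The monoid `⟨a_1, …, a_n⟩ ⊆ ℕ`. -/
def semigroupOf : AddSubmonoid ℕ := AddSubmonoid.closure (Set.range a)

/-- `{a_1, …, a_n}` is the minimal generating set (of size `n`) of `⟨a_1, …, a_n⟩`: no `a_i` lies in
the monoid generated by the others. -/
def IsMinimalGenerators : Prop := ∀ i, a i ∉ AddSubmonoid.closure (a '' {i}ᶜ)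

theorem mem_semigroupOf (i : Fin n) : a i ∈ semigroupOf a :=
  AddSubmonoid.subset_closure (Set.mem_range_self i)

/-- The generator `t^(a_i)` of `K[H]`, where `H = ⟨a_1, …, a_n⟩`. -/
def SemigroupRing.gen (i : Fin n) : SemigroupRing K (semigroupOf a) :=
  SemigroupRing.monomial K (a i) (mem_semigroupOf a i)

/-- The `K`-algebra homomorphism `S = K[x_1, …, x_n] → K[H]`, `x_i ↦ t^(a_i)`. -/
def toSemigroupRing : MvPolynomial (Fin n) K →+* SemigroupRing K (semigroupOf a) :=
  MvPolynomial.eval₂Hom (algebraMap K (SemigroupRing K (semigroupOf a))) (SemigroupRing.gen K a)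

/-- If `a_i ≠ 0` then `t^(a_i) ∈ 𝔪`. -/
theorem SemigroupRing.gen_mem (i : Fin n) (hi : a i ≠ 0) :
    SemigroupRing.gen K a i ∈ SemigroupRing.maxIdeal K (semigroupOf a) ^ 1 := by
  rw [pow_one]
  exact Ideal.subset_span ⟨a i, mem_semigroupOf a i, hi, rfl⟩

/-- The `K`-algebra homomorphism `S = K[x_1, …, x_n] → gr_𝔪 K[H]`, where `H = ⟨a_1, …, a_n⟩` with all
`a_i ≠ 0`, which maps `x_i` to the class of `t^(a_i)` in `𝔪 / 𝔪^2`. -/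
def toTangentCone (ha : ∀ i, a i ≠ 0) :
    MvPolynomial (Fin n) K →+* TangentCone K (semigroupOf a) :=
  MvPolynomial.eval₂Hom
    ((AssociatedGraded.ofZero (SemigroupRing.maxIdeal K (semigroupOf a))).comp
      (algebraMap K (SemigroupRing K (semigroupOf a))))
    (fun i => AssociatedGraded.of (SemigroupRing.maxIdeal K (semigroupOf a)) 1
      (SemigroupRing.gen K a i) (SemigroupRing.gen_mem K a i (ha i)))

end Semigroup

/-- The four generators of the Bresinsky semigroup `B_h`, `h ≥ 2`. -/
def bresinsky (h : ℕ) : Fin 4 → ℕ :=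
  ![(2 * h - 1) * (2 * h), (2 * h - 1) * (2 * h + 1), 2 * h * (2 * h + 1),
    2 * h * (2 * h + 1) + (2 * h - 1)]

theorem bresinsky_ne_zero {h : ℕ} (hh : 2 ≤ h) (i : Fin 4) : bresinsky h i ≠ 0 := by
  have h1 : 2 * h - 1 ≠ 0 := by omega
  have h2 : h ≠ 0 := by omega
  fin_cases i <;> simp [bresinsky] <;> omega

end

noncomputable section

/-! ### Complexes of finite free modules given by matrices, and their cones -/

/-! Put d = 2h - 1. The generators are d(d+1) + da + 2(d+1)b with a, b in {0, 1}, so the sums of n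
generators are the numbers d(d+1)n + du + 2(d+1)v with u, v ≤ n. Trading d+1 units of u for one of
n, or d units of v for two of n, does not change this number. Since d is odd, each element of B_h
has exactly one triple with u ≤ d, v < d and u, v ≤ n (`exists_normalForm`, `tripleDeg_injOn`). Both
trades raise n, so this n is the largest number of generators summing to the element, that is, its
𝔪-adic order (`hasOrder_tripleDeg`). The normal forms therefore index a K-basis of K[B_h] and also
of its tangent cone.

On either algebra A the first variable raises n by one and is a nonzerodivisor, and A/x₀A has the
basis (max u v, u, v). A product that leaves the range u ≤ d, v < d is a multiple of x₀ in K[B_h]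
and is zero in the tangent cone. Both quotients are thus the same module V over the other three
variables x, y, z, a "staircase" of dimension d(d+1); `IsMonomialBasis` records what the two
algebras share.

Tor against K is the homology of the Koszul complex on x₀, x, y, z with coefficients in A. As x₀ is
a nonzerodivisor, this is the Koszul homology of V in x, y, z (`bettiNumber_eq_rank`). As a ring V
is K[x,y,z]/J, where J is generated by xy, by x^(d+1-j) z^j for 0 ≤ j < d, and by y^(d-j) z^j for 0
≤ j ≤ d. So H_0 has dimension 1, H_1 counts the 2d+2 minimal relations, and H_3 is the socle, of
dimension 2d-1. The Euler characteristic (1-3+3-1) dim V = 0 then forces dim H_2 = 4d. -/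

/-- A nonnegatively graded complex of finite free `R`-modules, given by its matrices. -/
structure FreeComplex (R : Type u) [CommRing R] where
  idx : ℕ → Type
  fintype : ∀ n, Fintype (idx n)
  decEq : ∀ n, DecidableEq (idx n)
  mat : ∀ n, Matrix (idx n) (idx (n + 1)) R
  mat_mul : ∀ n, mat n * mat (n + 1) = 0

namespace FreeComplex

attribute [instance] fintype decEq

variable {R : Type u} [CommRing R]

section Homology

variable (C : FreeComplex R) (M : Type u) [AddCommGroup M] [Module R M]

/-- The differential of the complex `C ⊗ M`. -/
def d (n : ℕ) : (C.idx (n + 1) → M) →ₗ[R] (C.idx n → M) where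
  toFun f i := ∑ j, C.mat n i j • f j
  map_add' f g := by ext i; simp [Finset.sum_add_distrib]
  map_smul' r f := by ext i; simp [Finset.smul_sum, smul_comm r]

variable {M}

theorem d_apply (n : ℕ) (f : C.idx (n + 1) → M) (i : C.idx n) :
    C.d M n f i = ∑ j, C.mat n i j • f j := rfl

theorem d_d (n : ℕ) (f : C.idx (n + 2) → M) : C.d M n (C.d M (n + 1) f) = 0 := by
  ext i
  simp only [d_apply, Finset.smul_sum, Pi.zero_apply, smul_smul]
  rw [Finset.sum_comm]
  refine Finset.sum_eq_zero fun k _ => ?_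
  rw [← Finset.sum_smul]
  have := congrFun (congrFun (C.mat_mul n) i) k
  rw [Matrix.mul_apply] at this
  rw [this]
  simp

variable (M)

/-- The cycles of `C ⊗ M`. -/
def cycles : ∀ n, Submodule R (C.idx n → M)
  | 0 => ⊤
  | n + 1 => LinearMap.ker (C.d M n)

/-- The boundaries of `C ⊗ M`. -/
def boundaries (n : ℕ) : Submodule R (C.idx n → M) := LinearMap.range (C.d M n)

theorem boundaries_le_cycles : ∀ n, C.boundaries M n ≤ C.cycles M n
  | 0 => le_top
  | n + 1 => by
    rintro _ ⟨f, rfl⟩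
    exact C.d_d n f

/-- The homology of `C ⊗ M`. -/
abbrev homology (n : ℕ) : Type u :=
  ↥(C.cycles M n) ⧸ (C.boundaries M n).comap (C.cycles M n).subtype

variable {M} {M' : Type u} [AddCommGroup M'] [Module R M']

theorem map_d (p : M →ₗ[R] M') (n : ℕ) (f : C.idx (n + 1) → M) :
    p.compLeft (C.idx n) (C.d M n f) = C.d M' n (p.compLeft _ f) := by
  ext i
  simp [d_apply]

end Homology

/-- A linear map between spaces of cycles that induces an isomorphism in homology. -/
theorem nonempty_homology_equiv {C C' : FreeComplex R} {M M' : Type u} [AddCommGroup M] [Module R M]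
    [AddCommGroup M'] [Module R M'] {n : ℕ} (P : (C.idx n → M) →ₗ[R] (C'.idx n → M'))
    (hZ : ∀ f ∈ C.cycles M n, P f ∈ C'.cycles M' n)
    (hB : ∀ f ∈ C.boundaries M n, P f ∈ C'.boundaries M' n)
    (hinj : ∀ f ∈ C.cycles M n, P f ∈ C'.boundaries M' n → f ∈ C.boundaries M n)
    (hsurj : ∀ g ∈ C'.cycles M' n, ∃ f ∈ C.cycles M n, P f = g) :
    Nonempty (C.homology M n ≃ₗ[R] C'.homology M' n) := by
  let φ : C.homology M n →ₗ[R] C'.homology M' n :=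
    Submodule.mapQ _ _ (P.restrict hZ) (fun f hf => hB _ hf)
  refine ⟨LinearEquiv.ofBijective φ ⟨?_, ?_⟩⟩
  · rw [← LinearMap.ker_eq_bot, eq_bot_iff]
    intro x
    obtain ⟨f, rfl⟩ := Submodule.Quotient.mk_surjective _ x
    intro hx
    have h1 : Submodule.Quotient.mk (P.restrict hZ f) = (0 : C'.homology M' n) := hx
    rw [Submodule.Quotient.mk_eq_zero] at h1
    exact (Submodule.Quotient.mk_eq_zero _).2 (hinj f f.2 h1)
  · intro y
    obtain ⟨g, rfl⟩ := Submodule.Quotient.mk_surjective _ y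
    obtain ⟨f, hf, hfg⟩ := hsurj g g.2
    refine ⟨Submodule.Quotient.mk ⟨f, hf⟩, ?_⟩
    exact congrArg Submodule.Quotient.mk (Subtype.ext hfg)

/-! ### Cones of multiplication by a ring element, and Koszul complexes -/

section Cone

variable (x : R) (C : FreeComplex R)

/-- The index types of the cone of multiplication by a ring element. -/
@[reducible] def coneIdx (C : FreeComplex R) : ℕ → Type
  | 0 => C.idx 0
  | n + 1 => C.idx (n + 1) ⊕ C.idx n

/-- The matrices of the cone of multiplication by `x`. -/
def coneMat : ∀ n, Matrix (coneIdx C n) (coneIdx C (n + 1)) R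
  | 0 => Matrix.fromCols (C.mat 0) (x • (1 : Matrix (C.idx 0) (C.idx 0) R))
  | n + 1 => Matrix.fromBlocks (C.mat (n + 1)) (x • (1 : Matrix (C.idx (n + 1)) (C.idx (n + 1)) R)) 0 (-C.mat n)

/-- The cone of multiplication by `x` on `C`. -/
@[reducible] def cone : FreeComplex R where
  idx := coneIdx C
  fintype
    | 0 => C.fintype 0
    | n + 1 => inferInstanceAs (Fintype (C.idx (n + 1) ⊕ C.idx n))
  decEq
    | 0 => C.decEq 0
    | n + 1 => inferInstanceAs (DecidableEq (C.idx (n + 1) ⊕ C.idx n))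
  mat := coneMat x C
  mat_mul
    | 0 => by
      change Matrix.fromCols (C.mat 0) (x • (1 : Matrix (C.idx 0) (C.idx 0) R)) *
        Matrix.fromBlocks (C.mat 1) (x • (1 : Matrix (C.idx 1) (C.idx 1) R)) 0 (-C.mat 0) = 0
      rw [Matrix.fromCols_mul_fromBlocks]
      simp only [C.mat_mul]
      simp
    | n + 1 => by
      change Matrix.fromBlocks (C.mat (n + 1)) (x • (1 : Matrix (C.idx (n + 1)) (C.idx (n + 1)) R)) 0 (-C.mat n) *
        Matrix.fromBlocks (C.mat (n + 2)) (x • (1 : Matrix (C.idx (n + 2)) (C.idx (n + 2)) R)) 0 (-C.mat (n + 1)) = 0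
      rw [Matrix.fromBlocks_multiply]
      simp [C.mat_mul]

variable {M : Type u} [AddCommGroup M] [Module R M]

theorem cone_d_zero (f : C.idx 1 ⊕ C.idx 0 → M) :
    (cone x C).d M 0 f = C.d M 0 (f ∘ Sum.inl) + x • (f ∘ Sum.inr) := by
  ext i
  change ∑ j : C.idx 1 ⊕ C.idx 0, Matrix.fromCols (C.mat 0) (x • (1 : Matrix (C.idx 0) (C.idx 0) R)) i j • f j = _
  simp [Fintype.sum_sum_type, d_apply, Matrix.one_apply]

theorem cone_d_succ_inl (n : ℕ) (f : C.idx (n + 2) ⊕ C.idx (n + 1) → M) :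
    (cone x C).d M (n + 1) f ∘ Sum.inl =
      C.d M (n + 1) (f ∘ Sum.inl) + x • (f ∘ Sum.inr) := by
  ext i
  change ∑ j : C.idx (n + 2) ⊕ C.idx (n + 1),
    Matrix.fromBlocks (C.mat (n + 1)) (x • (1 : Matrix (C.idx (n + 1)) (C.idx (n + 1)) R)) 0 (-C.mat n) (Sum.inl i) j • f j = _
  simp [Fintype.sum_sum_type, d_apply, Matrix.one_apply]

theorem cone_d_succ_inr (n : ℕ) (f : C.idx (n + 2) ⊕ C.idx (n + 1) → M) :
    (cone x C).d M (n + 1) f ∘ Sum.inr = - C.d M n (f ∘ Sum.inr) := by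
  ext i
  change ∑ j : C.idx (n + 2) ⊕ C.idx (n + 1),
    Matrix.fromBlocks (C.mat (n + 1)) (x • (1 : Matrix (C.idx (n + 1)) (C.idx (n + 1)) R)) 0 (-C.mat n) (Sum.inr i) j • f j = _
  simp [Fintype.sum_sum_type, d_apply]

theorem cone_d_succ (n : ℕ) (f : C.idx (n + 2) ⊕ C.idx (n + 1) → M) :
    (cone x C).d M (n + 1) f =
      Sum.elim (C.d M (n + 1) (f ∘ Sum.inl) + x • (f ∘ Sum.inr)) (- C.d M n (f ∘ Sum.inr)) := by
  rw [← cone_d_succ_inl, ← cone_d_succ_inr]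
  exact (Sum.elim_comp_inl_inr _).symm

variable {M' : Type u} [AddCommGroup M'] [Module R M'] {x}

/-- If `x` is a nonzerodivisor on `M`, then the cone of `x` on `C ⊗ M` computes the homology of
`C ⊗ M / xM`. -/
theorem nonempty_cone_homology_equiv (hx : Function.Injective fun m : M => x • m)
    (p : M →ₗ[R] M') (hp : Function.Surjective p) (hker : ∀ m, p m = 0 ↔ ∃ m', x • m' = m) (n : ℕ) :
    Nonempty ((cone x C).homology M n ≃ₗ[R] C.homology M' n) := by
  have hxp : ∀ m, p (x • m) = 0 := fun m => (hker _).2 ⟨m, rfl⟩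
  have hxI : ∀ {ι : Type} (f g : ι → M), x • f = x • g → f = g := fun f g h =>
    funext fun i => hx (congrFun h i)
  have hxC : ∀ {ι : Type} (f : ι → M), p.compLeft ι (x • f) = 0 := fun f => funext fun i => hxp _
  have hC : ∀ {ι : Type} (f : ι → M), p.compLeft ι f = 0 → ∃ g : ι → M, x • g = f := by
    intro ι f hf
    choose g hg using fun i => (hker (f i)).1 (congrFun hf i)
    exact ⟨g, funext hg⟩
  have hS : ∀ {ι : Type} (f : ι → M'), ∃ g : ι → M, p.compLeft ι g = f := by
    intro ι f
    choose g hg using fun i => hp (f i)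
    exact ⟨g, funext hg⟩
  match n with
  | 0 =>
    refine nonempty_homology_equiv (C := cone x C) (C' := C) (p.compLeft (C.idx 0)) ?_ ?_ ?_ ?_
    · intro f _
      trivial
    · rintro _ ⟨f, rfl⟩
      rw [cone_d_zero, map_add, hxC, add_zero, map_d]
      exact ⟨_, rfl⟩
    · rintro f - ⟨c', hc'⟩
      obtain ⟨c, rfl⟩ := hS c'
      rw [← map_d] at hc'
      obtain ⟨e, he⟩ := hC (f - C.d M 0 c) (by rw [map_sub, hc', sub_self])
      refine ⟨Sum.elim c e, ?_⟩
      rw [cone_d_zero, Sum.elim_comp_inl, Sum.elim_comp_inr, he]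
      abel
    · intro g _
      obtain ⟨f, rfl⟩ := hS g
      exact ⟨f, trivial, rfl⟩
  | n + 1 =>
    have hcyc : ∀ a b, Sum.elim a b ∈ (cone x C).cycles M (n + 1) ↔
        C.d M n a + x • b = 0 ∧ b ∈ C.cycles M n := by
      intro a b
      match n with
      | 0 =>
        change (cone x C).d M 0 _ = 0 ↔ _
        rw [cone_d_zero, Sum.elim_comp_inl, Sum.elim_comp_inr]
        exact ⟨fun h => ⟨h, trivial⟩, fun h => h.1⟩
      | n + 1 =>
        change (cone x C).d M (n + 1) _ = 0 ↔ _ ∧ C.d M n b = 0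
        rw [cone_d_succ, Sum.elim_comp_inl, Sum.elim_comp_inr]
        constructor
        · intro h
          exact ⟨funext fun i => congrFun h (Sum.inl i),
            neg_eq_zero.1 (funext fun i => congrFun h (Sum.inr i))⟩
        · rintro ⟨h1, h2⟩
          rw [h1, h2]
          ext (i | i) <;> simp
    refine nonempty_homology_equiv (C := cone x C) (C' := C)
      ((p.compLeft (C.idx (n + 1))).comp (LinearMap.funLeft R M Sum.inl)) ?_ ?_ ?_ ?_
    · intro f hf
      obtain ⟨a, b, rfl⟩ : ∃ a b, f = Sum.elim a b := ⟨_, _, (Sum.elim_comp_inl_inr f).symm⟩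
      have h1 := ((hcyc a b).1 hf).1
      change C.d M' n (p.compLeft _ a) = 0
      rw [← map_d, eq_neg_of_add_eq_zero_left h1, map_neg, hxC, neg_zero]
    · rintro _ ⟨f, rfl⟩
      rw [cone_d_succ]
      change p.compLeft _ (C.d M (n + 1) (f ∘ Sum.inl) + x • (f ∘ Sum.inr)) ∈ _
      rw [map_add, hxC, add_zero, map_d]
      exact ⟨_, rfl⟩
    · rintro f hf ⟨c', hc'⟩
      obtain ⟨a, b, rfl⟩ : ∃ a b, f = Sum.elim a b := ⟨_, _, (Sum.elim_comp_inl_inr f).symm⟩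
      have h1 := ((hcyc a b).1 hf).1
      change _ = p.compLeft _ a at hc'
      obtain ⟨c, rfl⟩ := hS c'
      rw [← map_d] at hc'
      obtain ⟨e, he⟩ := hC (a - C.d M (n + 1) c) (by rw [map_sub, hc', sub_self])
      refine ⟨Sum.elim c e, ?_⟩
      -- The cycle condition d a + x b = 0 and a = d c + x e give x b = x (-d e), and x can be
      -- cancelled.
      have hb : b = - C.d M n e := by
        apply hxI
        rw [smul_neg, ← map_smul, he, map_sub, C.d_d, sub_zero]
        exact eq_neg_of_add_eq_zero_right h1
      rw [cone_d_succ, Sum.elim_comp_inl, Sum.elim_comp_inr, he, ← hb]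
      simp
    · intro g hg
      obtain ⟨a, rfl⟩ := hS g
      have hg : C.d M' n (p.compLeft _ a) = 0 := hg
      rw [← map_d] at hg
      obtain ⟨b, hb⟩ := hC _ hg
      -- The lift a is a cycle only modulo x, with d a = x b, and -b is the second coordinate that
      -- repairs this. That b is itself a cycle follows from x (d b) = d (d a) = 0.
      refine ⟨Sum.elim a (-b), (hcyc _ _).2 ⟨by rw [← hb, smul_neg, add_neg_cancel], ?_⟩, rfl⟩
      match n with
      | 0 => trivial
      | n + 1 =>
        apply hxI
        rw [← map_smul, smul_neg, hb, map_neg, C.d_d, smul_zero, neg_zero]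

end Cone

/-- The complex `R` concentrated in degree zero. -/
@[reducible] def unit (R : Type u) [CommRing R] : FreeComplex R where
  idx
    | 0 => Unit
    | _ + 1 => Empty
  fintype
    | 0 => inferInstanceAs (Fintype Unit)
    | _ + 1 => inferInstanceAs (Fintype Empty)
  decEq
    | 0 => inferInstanceAs (DecidableEq Unit)
    | _ + 1 => inferInstanceAs (DecidableEq Empty)
  mat _ := 0
  mat_mul _ := Matrix.zero_mul _

/-- The Koszul complex of a sequence of ring elements. -/
@[reducible] def koszul : List R → FreeComplex R
  | [] => unit R
  | x :: l => cone x (koszul l)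

open scoped Pointwise in
/-- The Koszul complex on a weakly regular sequence has no homology in positive degrees. -/
theorem koszul_homology_subsingleton (l : List R) (M : Type u) [AddCommGroup M] [Module R M]
    (h : RingTheory.Sequence.IsWeaklyRegular M l) (n : ℕ) :
    Subsingleton ((koszul l).homology M (n + 1)) := by
  induction l generalizing M with
  | nil =>
    have : Subsingleton ((koszul ([] : List R)).idx (n + 1) → M) :=
      inferInstanceAs (Subsingleton (Empty → M))
    infer_instance
  | cons x l ih =>
    rw [RingTheory.Sequence.isWeaklyRegular_cons_iff] at h
    obtain ⟨e⟩ := nonempty_cone_homology_equiv (x := x) (koszul l) h.1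
      (Submodule.mkQ (x • ⊤ : Submodule R M)) (Submodule.mkQ_surjective _) (by
        intro m
        simp [Submodule.mem_smul_pointwise_iff_exists]) (n + 1)
    have := ih _ h.2
    exact e.toEquiv.subsingleton

end FreeComplex

end

noncomputable section

/-! ### `Tor` via a resolution by finite free modules -/

namespace FreeComplex

open CategoryTheory
open scoped TensorProduct

variable {R : Type u} [CommRing R] (C : FreeComplex R)

section

variable (M : Type u) [AddCommGroup M] [Module R M]

/-- The chain complex `C ⊗ M`. -/
def chainComplex : ChainComplex (ModuleCat.{u} R) ℕ :=
  ChainComplex.of (fun n => ModuleCat.of R (C.idx n → M)) (fun n => ModuleCat.ofHom (C.d M n))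
    (fun n => by
      refine ModuleCat.hom_ext (LinearMap.ext fun f => ?_)
      exact C.d_d n f)

theorem chainComplex_d (n : ℕ) :
    (C.chainComplex M).d (n + 1) n = ModuleCat.ofHom (C.d M n) :=
  ChainComplex.of_d (fun n => ModuleCat.of R (C.idx n → M)) (fun n => ModuleCat.ofHom (C.d M n)) n

/-- Links the concrete quotient of cycles by boundaries with categorical homology. Degree 0 is
separate because there the outgoing differential is zero and all chains are cycles. -/
theorem nonempty_homology_iso (n : ℕ) :
    Nonempty ((C.chainComplex M).homology n ≅ ModuleCat.of R (C.homology M n)) := by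
  match n with
  | 0 =>
    let S := (C.chainComplex M).sc' 1 0 0
    have e1 : (C.chainComplex M).homology 0 ≅ S.homology :=
      ShortComplex.homologyMapIso ((C.chainComplex M).isoSc' 1 0 0 (by simp) (by simp))
    have hg : S.g = 0 := (C.chainComplex M).shape _ _ (by simp)
    have hf : S.f = ModuleCat.ofHom (C.d M 0) := C.chainComplex_d M 0
    have hg0 : LinearMap.ker S.g.hom = C.cycles M 0 := by
      rw [hg]
      exact LinearMap.ker_zero
    refine ⟨e1 ≪≫ S.moduleCatHomologyIso ≪≫ LinearEquiv.toModuleIso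
      (Submodule.Quotient.equiv _ _ (LinearEquiv.ofEq _ _ hg0) ?_)⟩
    · ext f
      constructor
      · rintro ⟨_, ⟨g, rfl⟩, rfl⟩
        exact ⟨g, (congrArg (fun φ => φ.hom g) hf).symm⟩
      · rintro ⟨g, hg⟩
        refine ⟨⟨f.1, by rw [hg0]; trivial⟩, ⟨g, Subtype.ext ?_⟩, Subtype.ext rfl⟩
        exact (congrArg (fun φ => φ.hom g) hf).trans hg
  | n + 1 =>
    let S := (C.chainComplex M).sc' (n + 2) (n + 1) n
    have e1 : (C.chainComplex M).homology (n + 1) ≅ S.homology :=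
      ShortComplex.homologyMapIso ((C.chainComplex M).isoSc' (n + 2) (n + 1) n (by simp) (by simp))
    have hg : S.g = ModuleCat.ofHom (C.d M n) := C.chainComplex_d M n
    have hf : S.f = ModuleCat.ofHom (C.d M (n + 1)) := C.chainComplex_d M (n + 1)
    have hker : LinearMap.ker S.g.hom = C.cycles M (n + 1) := by
      rw [hg]
      rfl
    refine ⟨e1 ≪≫ S.moduleCatHomologyIso ≪≫ LinearEquiv.toModuleIso
      (Submodule.Quotient.equiv _ _ (LinearEquiv.ofEq _ _ hker) ?_)⟩
    ext f
    constructor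
    · rintro ⟨_, ⟨g, rfl⟩, rfl⟩
      exact ⟨g, (congrArg (fun φ => φ.hom g) hf).symm⟩
    · rintro ⟨g, hg⟩
      refine ⟨⟨f.1, by rw [hker]; exact f.2⟩, ⟨g, Subtype.ext ?_⟩, Subtype.ext rfl⟩
      exact (congrArg (fun φ => φ.hom g) hf).trans hg

/-- Makes the isomorphisms M ⊗ Rⁿ ≃ Mⁿ compatible with the differentials. -/
theorem d_piScalarRight (n : ℕ) (a : M) (f : C.idx (n + 1) → R) :
    C.d M n (TensorProduct.piScalarRight R R M (C.idx (n + 1)) (a ⊗ₜ f)) =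
      TensorProduct.piScalarRight R R M (C.idx n) (a ⊗ₜ (C.d R n f)) := by
  ext i
  simp only [TensorProduct.piScalarRight_apply, TensorProduct.piScalarRightHom_tmul, d_apply,
    smul_smul, Finset.sum_smul, smul_eq_mul]

end

/-- If `C` is a resolution of `N`, then `C ⊗ A` computes `Tor(A, N)`. -/
theorem nonempty_tor_iso (hC : ∀ n, Subsingleton (C.homology R (n + 1))) (N : ModuleCat.{u} R)
    (ε : (C.idx 0 → R) →ₗ[R] N) (hε : Function.Surjective ε)
    (hker : LinearMap.ker ε = C.boundaries R 0) (A : ModuleCat.{u} R) (n : ℕ) :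
    Nonempty (((Tor (ModuleCat.{u} R) n).obj A).obj N ≅ ModuleCat.of R (C.homology A n)) := by
  have hd : (C.chainComplex R).d 1 0 ≫ ModuleCat.ofHom ε = 0 := by
    rw [chainComplex_d]
    ext f : 2
    have : C.d R 0 f ∈ LinearMap.ker ε := by
      rw [hker]
      exact ⟨f, rfl⟩
    exact this
  have hπ : ((ChainComplex.toSingle₀Equiv (C.chainComplex R) N).symm ⟨ModuleCat.ofHom ε, hd⟩).f 0 =
      ModuleCat.ofHom ε :=
    ChainComplex.toSingle₀Equiv_symm_apply_f_zero (C := C.chainComplex R) (X := N) _ hd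
  let P : ProjectiveResolution N :=
    { complex := C.chainComplex R
      projective := fun n => by
        change Projective (ModuleCat.of R (C.idx n → R))
        infer_instance
      π := (ChainComplex.toSingle₀Equiv _ _).symm ⟨ModuleCat.ofHom ε, hd⟩
      -- In degree 0 the claim is exactness of C₁ → C₀ → N → 0; in higher degrees it is the
      -- vanishing of homology.
      quasiIso := ⟨fun n => by
        cases n with
        | zero =>
          rw [ChainComplex.quasiIsoAt₀_iff, ShortComplex.quasiIso_iff_of_zeros']
          · refine (ShortComplex.exact_and_epi_g_iff_of_iso ?_).2
              (show (ShortComplex.mk (ModuleCat.ofHom (C.d R 0)) (ModuleCat.ofHom ε) (by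
                rw [← chainComplex_d]; exact hd)).Exact ∧ Epi (ModuleCat.ofHom ε) from ⟨?_, ?_⟩)
            · exact ShortComplex.isoMk (Iso.refl _) (Iso.refl _) (Iso.refl _)
                ((Category.id_comp _).trans ((C.chainComplex_d R 0).symm.trans
                  (Category.comp_id _).symm))
                ((Category.id_comp _).trans (hπ.symm.trans (Category.comp_id _).symm))
            · rw [ShortComplex.moduleCat_exact_iff_range_eq_ker]
              exact hker.symm
            · exact (ModuleCat.epi_iff_surjective _).2 hε
          all_goals rfl
        | succ n =>
          rw [quasiIsoAt_iff_exactAt']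
          · rw [HomologicalComplex.exactAt_iff_isZero_homology]
            obtain ⟨e⟩ := C.nonempty_homology_iso R (n + 1)
            have := hC n
            exact (ModuleCat.isZero_of_subsingleton _).of_iso e
          · apply ChainComplex.exactAt_succ_single_obj⟩ }
  let F := (MonoidalCategory.tensoringLeft (ModuleCat.{u} R)).obj A
  obtain ⟨e⟩ := C.nonempty_homology_iso A n
  have e2 : (F.mapHomologicalComplex _).obj P.complex ≅ C.chainComplex A := by
    refine HomologicalComplex.Hom.isoOfComponents (fun i =>
      LinearEquiv.toModuleIso (TensorProduct.piScalarRight R R A (C.idx i))) ?_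
    rintro i j (rfl : j + 1 = i)
    rw [chainComplex_d]
    change _ = F.map ((C.chainComplex R).d (j + 1) j) ≫ _
    rw [chainComplex_d]
    refine ModuleCat.hom_ext (TensorProduct.ext' fun a f => ?_)
    exact C.d_piScalarRight A j a f
  exact ⟨P.isoLeftDerivedObj F n ≪≫ (HomologicalComplex.homologyFunctor _ _ n).mapIso e2 ≪≫ e⟩

end FreeComplex

end

noncomputable section

/-! ### Betti numbers as ranks of Koszul homology -/

open FreeComplex

section BettiNumber

variable {K : Type u} [Field K]

/-- A polynomial lies in an ideal generated by variables iff each of its monomials involves one of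
them, and multiplying by a further variable does not affect this. -/
theorem MvPolynomial.isWeaklyRegular_X :
    RingTheory.Sequence.IsWeaklyRegular (MvPolynomial (Fin 4) K)
      [(X 0 : MvPolynomial (Fin 4) K), X 1, X 2, X 3] := by
  have key : ∀ (s : Set (Fin 4)) (i : Fin 4) (f : MvPolynomial (Fin 4) K), i ∉ s →
      X i * f ∈ Ideal.span (X '' s) → f ∈ Ideal.span (X '' s) := by
    intro s i f hi hf
    rw [mem_ideal_span_X_image] at hf ⊢
    intro m hm
    obtain ⟨j, hj, hmj⟩ := hf (Finsupp.single i 1 + m) (by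
      rw [support_X_mul]
      exact Finset.mem_map.2 ⟨m, hm, rfl⟩)
    refine ⟨j, hj, ?_⟩
    have : i ≠ j := fun h => hi (h ▸ hj)
    simpa [Finsupp.single_apply, this] using hmj
  have key' : ∀ (l : List (MvPolynomial (Fin 4) K)) (s : Set (Fin 4)) (i : Fin 4), i ∉ s →
      {r | r ∈ l} = X '' s → IsSMulRegular
        (MvPolynomial (Fin 4) K ⧸
          (Ideal.ofList l • ⊤ : Submodule (MvPolynomial (Fin 4) K) (MvPolynomial (Fin 4) K)))
        (X i : MvPolynomial (Fin 4) K) := by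
    intro l s i hi hl
    have hI : (Ideal.ofList l • ⊤ : Submodule (MvPolynomial (Fin 4) K) (MvPolynomial (Fin 4) K)) =
        Ideal.span (X '' s) := by
      rw [smul_eq_mul, Ideal.mul_top, Ideal.ofList, hl]
    rw [hI, isSMulRegular_iff_right_eq_zero_of_smul]
    intro x hx
    obtain ⟨f, rfl⟩ := Submodule.Quotient.mk_surjective _ x
    rw [← Submodule.Quotient.mk_smul, Submodule.Quotient.mk_eq_zero] at hx
    exact (Submodule.Quotient.mk_eq_zero _).2 (key s i f hi hx)
  rw [RingTheory.Sequence.isWeaklyRegular_iff_Fin]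
  intro i
  fin_cases i
  · exact key' [] ∅ 0 (by simp) (by simp)
  · exact key' [X 0] {0} 1 (by simp) (by ext; simp)
  · exact key' [X 0, X 1] {0, 1} 2 (by simp) (by ext; simp [Set.image_insert_eq])
  · exact key' [X 0, X 1, X 2] {0, 1, 2} 3 (by simp) (by ext; simp [Set.image_insert_eq])

open MvPolynomial

theorem unit_d {R : Type u} [CommRing R] {M : Type u} [AddCommGroup M] [Module R M] (n : ℕ)
    (f : (unit R).idx (n + 1) → M) : (unit R).d M n f = 0 := by
  ext i
  rw [d_apply]
  exact Finset.sum_eq_zero fun _ _ => zero_smul R _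

theorem koszul_four_d_zero {R : Type u} [CommRing R] (x₀ x₁ x₂ x₃ : R)
    (f : (((Empty ⊕ Unit) ⊕ Unit) ⊕ Unit) ⊕ Unit → R) :
    (koszul [x₀, x₁, x₂, x₃]).d R 0 f () =
      x₃ * f (.inl (.inl (.inl (.inr ())))) + x₂ * f (.inl (.inl (.inr ()))) +
        x₁ * f (.inl (.inr ())) + x₀ * f (.inr ()) := by
  rw [cone_d_zero, cone_d_zero, cone_d_zero, cone_d_zero, unit_d]
  simp

variable (K) in
/-- The augmentation `K[x₀, …, x₃] → K`. -/
def augmentation : (Unit → MvPolynomial (Fin 4) K) →ₗ[MvPolynomial (Fin 4) K]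
    (ModuleCat.restrictScalars (constantCoeff (σ := Fin 4) (R := K))).obj (ModuleCat.of K K) where
  toFun f := (constantCoeff (f ()) : K)
  map_add' f g := map_add constantCoeff (f ()) (g ())
  map_smul' r f := map_mul constantCoeff r (f ())

theorem ker_augmentation :
    LinearMap.ker (augmentation K) =
      (koszul [(X 0 : MvPolynomial (Fin 4) K), X 1, X 2, X 3]).boundaries
        (MvPolynomial (Fin 4) K) 0 := by
  ext f
  constructor
  · intro hf
    have hf : constantCoeff (f ()) = 0 := hf
    have h1 : f () ∈ Ideal.span (Set.range (X : Fin 4 → MvPolynomial (Fin 4) K)) := by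
      rw [← Set.image_univ, mem_ideal_span_X_image]
      intro m hm
      -- A monomial involving no variable is 1, and its coefficient is the constant term, assumed
      -- zero.
      by_contra! h
      have : m = 0 := Finsupp.ext fun i => h i trivial
      subst this
      exact mem_support_iff.1 hm hf
    obtain ⟨c, hc⟩ := (Ideal.mem_span_range_iff_exists_fun).1 h1
    refine ⟨Sum.elim (Sum.elim (Sum.elim (Sum.elim Empty.elim fun _ => c 3) fun _ => c 2)
      fun _ => c 1) fun _ => c 0, ?_⟩
    ext1 ⟨⟩
    rw [← hc]
    refine (koszul_four_d_zero _ _ _ _ _).trans ?_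
    rw [Fin.sum_univ_four]
    simp only [Sum.elim_inl, Sum.elim_inr]
    ring
  · rintro ⟨g, rfl⟩
    change constantCoeff ((koszul [(X 0 : MvPolynomial (Fin 4) K), X 1, X 2, X 3]).d _ 0 g ()) = 0
    refine (congrArg constantCoeff (koszul_four_d_zero _ _ _ _ g)).trans ?_
    simp

/-- If `x₀` is a nonzerodivisor on `A` and `V = A / x₀ A`, then the Betti numbers of `A` are the
dimensions of the Koszul homology of `V` with respect to the other variables. -/
theorem bettiNumber_eq_rank {A : Type u} [CommRing A] (φ : MvPolynomial (Fin 4) K →+* A)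
    {V : Type u} [AddCommGroup V] [Module (MvPolynomial (Fin 4) K) V] [Module K V]
    [IsScalarTower K (MvPolynomial (Fin 4) K) V] (p : A →+ V) (hp : ∀ s a, p (φ s * a) = s • p a)
    (hsurj : Function.Surjective p) (hreg : ∀ a, φ (X 0) * a = 0 → a = 0)
    (hker : ∀ a, p a = 0 ↔ ∃ b, φ (X 0) * b = a) (i : ℕ) :
    bettiNumber K φ i = Module.rank K
      ((koszul [(X 1 : MvPolynomial (Fin 4) K), X 2, X 3]).homology V i) := by
  let M := (ModuleCat.restrictScalars φ).obj (ModuleCat.of A A)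
  obtain ⟨e1⟩ := nonempty_tor_iso (koszul [(X 0 : MvPolynomial (Fin 4) K), X 1, X 2, X 3])
    (koszul_homology_subsingleton _ _ isWeaklyRegular_X)
    ((ModuleCat.restrictScalars (constantCoeff (σ := Fin 4) (R := K))).obj (ModuleCat.of K K))
    (augmentation K) (fun c : K => ⟨fun _ => C c, constantCoeff_C _ c⟩) ker_augmentation M i
  obtain ⟨e2⟩ := nonempty_cone_homology_equiv (x := (X 0 : MvPolynomial (Fin 4) K))
    (koszul [(X 1 : MvPolynomial (Fin 4) K), X 2, X 3]) (M := M) (M' := V)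
    (fun (a b : A) (hab : φ (X 0) * a = φ (X 0) * b) =>
      sub_eq_zero.1 (hreg (a - b) (by rw [mul_sub, hab, sub_self])))
    { toFun := p, map_add' := p.map_add, map_smul' := hp } hsurj hker i
  let e := e1.toLinearEquiv.trans e2
  -- K acts on Tor through the constant polynomials; the scalar tower identifies this with the given
  -- K-action on V.
  let e' : ((ModuleCat.restrictScalars (C (σ := Fin 4) (R := K))).obj _) ≃ₗ[K]
      ((koszul [(X 1 : MvPolynomial (Fin 4) K), X 2, X 3]).homology V i) :=
    { e.toAddEquiv with
      map_smul' := fun c t => (e.map_smul (C c) t).trans (algebraMap_smul _ c (e t)) }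
  exact e'.rank_eq

end BettiNumber

end

noncomputable section

/-! ### Dimensions of Koszul homology -/

namespace FreeComplex

section Dimension

variable {K R V : Type u} [Field K] [CommRing R] [Algebra K R] [AddCommGroup V] [Module R V]
  [Module K V] [IsScalarTower K R V] (C : FreeComplex R) (n : ℕ)

/-- A `K`-linear map that separates cycles modulo boundaries computes the dimension of homology. -/
theorem rank_homology_eq {W : Type u} [AddCommGroup W] [Module K W]
    (Φ : (C.idx n → V) →ₗ[K] W) (hsurj : ∀ w, ∃ f ∈ C.cycles V n, Φ f = w)
    (hker : ∀ f ∈ C.cycles V n, Φ f = 0 → f ∈ C.boundaries V n)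
    (hbd : ∀ f ∈ C.boundaries V n, Φ f = 0) :
    Module.rank K (C.homology V n) = Module.rank K W := by
  let Ψ : C.homology V n →+ W := QuotientAddGroup.lift _
    (Φ.toAddMonoidHom.comp (C.cycles V n).subtype.toAddMonoidHom) (fun f hf => hbd _ hf)
  let Ψ' : C.homology V n →ₗ[K] W :=
    { Ψ with
      map_smul' := fun c x => by
        obtain ⟨f, rfl⟩ := Submodule.Quotient.mk_surjective _ x
        exact Φ.map_smul c f }
  refine (LinearEquiv.ofBijective Ψ' ⟨?_, ?_⟩).rank_eq
  · rw [← LinearMap.ker_eq_bot, eq_bot_iff]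
    intro x hx
    obtain ⟨f, rfl⟩ := Submodule.Quotient.mk_surjective _ x
    exact (Submodule.Quotient.mk_eq_zero _).2 (hker f f.2 hx)
  · intro w
    obtain ⟨f, hf, rfl⟩ := hsurj w
    exact ⟨Submodule.Quotient.mk ⟨f, hf⟩, rfl⟩

variable [FiniteDimensional K V]

instance : FiniteDimensional K (C.cycles V n) :=
  inferInstanceAs (FiniteDimensional K ((C.cycles V n).restrictScalars K))

theorem finiteDimensional_homology : FiniteDimensional K (C.homology V n) :=
  Module.Finite.equiv (Submodule.Quotient.restrictScalarsEquiv K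
    ((C.boundaries V n).comap (C.cycles V n).subtype))

theorem finrank_homology_add_finrank_boundaries :
    Module.finrank K (C.homology V n) + Module.finrank K (C.boundaries V n) =
      Module.finrank K (C.cycles V n) := by
  let N := (C.boundaries V n).comap (C.cycles V n).subtype
  rw [← Submodule.finrank_quotient_add_finrank (N.restrictScalars K)]
  congr 1
  exact ((Submodule.comapSubtypeEquivOfLe (C.boundaries_le_cycles V n)).restrictScalars
    K).finrank_eq.symm

theorem finrank_cycles_zero :
    Module.finrank K (C.cycles V 0) = Fintype.card (C.idx 0) * Module.finrank K V := by
  refine (LinearEquiv.ofTop ((⊤ : Submodule R (C.idx 0 → V)).restrictScalars K) rfl).finrank_eq.trans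
    ?_
  simp [Module.finrank_pi_fintype]

theorem finrank_cycles_succ_add_finrank_boundaries :
    Module.finrank K (C.cycles V (n + 1)) + Module.finrank K (C.boundaries V n) =
      Fintype.card (C.idx (n + 1)) * Module.finrank K V := by
  rw [add_comm]
  refine (LinearMap.finrank_range_add_finrank_ker ((C.d V n).restrictScalars K)).trans ?_
  simp [Module.finrank_pi_fintype]

end Dimension

/-! ### Coordinates on the Koszul complex in three variables -/

section ThreeVariables

variable {R M : Type u} [CommRing R] (x y z : R)

/-- The degree one part of the Koszul complex in three variables. -/
def deg1 (fx fy fz : M) : (koszul [x, y, z]).idx 1 → M :=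
  Sum.elim (Sum.elim (Sum.elim Empty.elim fun _ => fz) fun _ => fy) fun _ => fx

/-- The degree two part of the Koszul complex in three variables. -/
def deg2 (gxy gxz gyz : M) : (koszul [x, y, z]).idx 2 → M :=
  Sum.elim (Sum.elim (Sum.elim Empty.elim Empty.elim) (Sum.elim Empty.elim fun _ => gyz))
    (Sum.elim (Sum.elim Empty.elim fun _ => gxz) fun _ => gxy)

/-- The degree three part of the Koszul complex in three variables. -/
def deg3 (w : M) : (koszul [x, y, z]).idx 3 → M :=
  Sum.elim (Sum.elim (Sum.elim Empty.elim Empty.elim) (Sum.elim Empty.elim Empty.elim))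
    (Sum.elim (Sum.elim Empty.elim Empty.elim) (Sum.elim Empty.elim fun _ => w))

variable {x y z}

/-- All other summands of the index type are `Empty`; likewise in degrees two and three below. -/
theorem eq_deg1 (f : (koszul [x, y, z]).idx 1 → M) :
    f = deg1 x y z (f (.inr ())) (f (.inl (.inr ()))) (f (.inl (.inl (.inr ())))) := by
  funext i
  rcases i with ((i | i) | i) | i <;> first | exact i.elim | rfl

theorem eq_deg2 (f : (koszul [x, y, z]).idx 2 → M) :
    f = deg2 x y z (f (.inr (.inr ()))) (f (.inr (.inl (.inr ())))) (f (.inl (.inr (.inr ())))) := by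
  funext i
  rcases i with ((i | i) | (i | i)) | ((i | i) | i) <;> first | exact i.elim | rfl

theorem eq_deg3 (f : (koszul [x, y, z]).idx 3 → M) :
    f = deg3 x y z (f (.inr (.inr (.inr ())))) := by
  funext i
  rcases i with ((i | i) | (i | i)) | ((i | i) | (i | i)) <;> first | exact i.elim | rfl

variable [AddCommGroup M] [Module R M]

theorem cone_d_zero_elim (x : R) (C : FreeComplex R) (a : C.idx 1 → M) (b : C.idx 0 → M) :
    (cone x C).d M 0 (Sum.elim a b) = C.d M 0 a + x • b := cone_d_zero x C _

theorem cone_d_succ_elim (x : R) (C : FreeComplex R) (n : ℕ) (a : C.idx (n + 2) → M)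
    (b : C.idx (n + 1) → M) :
    (cone x C).d M (n + 1) (Sum.elim a b) = Sum.elim (C.d M (n + 1) a + x • b) (-C.d M n b) :=
  cone_d_succ x C n _

theorem koszul_d_zero (fx fy fz : M) :
    (koszul [x, y, z]).d M 0 (deg1 x y z fx fy fz) =
      fun _ => x • fx + y • fy + z • fz := by
  unfold deg1
  rw [cone_d_zero_elim, cone_d_zero_elim, cone_d_zero_elim, unit_d]
  funext i
  simp
  abel

theorem koszul_d_one (gxy gxz gyz : M) :
    (koszul [x, y, z]).d M 1 (deg2 x y z gxy gxz gyz) =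
      deg1 x y z (-(y • gxy) - z • gxz) (x • gxy - z • gyz) (x • gxz + y • gyz) := by
  unfold deg2
  rw [cone_d_succ_elim, cone_d_succ_elim, cone_d_succ_elim, cone_d_zero_elim, cone_d_zero_elim,
    cone_d_zero_elim, unit_d, unit_d]
  funext i
  rcases i with ((i | i) | i) | i
  · exact i.elim
  all_goals
    simp [deg1]
    try abel

theorem koszul_d_two (w : M) :
    (koszul [x, y, z]).d M 2 (deg3 x y z w) = deg2 x y z (z • w) (-(y • w)) (x • w) := by
  unfold deg3
  rw [cone_d_succ_elim, cone_d_succ_elim, cone_d_succ_elim, cone_d_succ_elim, cone_d_succ_elim,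
    cone_d_zero_elim, cone_d_succ_elim, unit_d 0]
  funext i
  rcases i with ((i | i) | (i | i)) | ((i | i) | i)
  all_goals first | exact Empty.elim i | simp [deg2]

end ThreeVariables

end FreeComplex

end

noncomputable section

/-! ### Koszul homology of a staircase module -/

open FreeComplex

/-- `c` identifies `V` with the space of functions on `{0, …, d} × {0, …, d - 1}`, on which
`x`, `y`, `z` act by shifting by `(1, 0)` on `u ≥ v`, by `(0, 1)` on `u ≤ v` and by `(1, 1)`,
respectively. -/
structure IsStaircase {K R V : Type u} [Field K] [CommRing R] [AddCommGroup V] [Module R V]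
    [Module K V] (d : ℕ) (x y z : R) (c : V →ₗ[K] (ℕ → ℕ → K)) : Prop where
  injective : Function.Injective c
  supported : ∀ m u v, ¬ (u ≤ d ∧ v < d) → c m u v = 0
  exists_eq : ∀ F : ℕ → ℕ → K, (∀ u v, ¬ (u ≤ d ∧ v < d) → F u v = 0) → ∃ m, c m = F
  x_smul : ∀ m u v, c (x • m) u v = if v < u ∧ u ≤ d ∧ v < d then c m (u - 1) v else 0
  y_smul : ∀ m u v, c (y • m) u v = if u < v ∧ v < d then c m u (v - 1) else 0
  z_smul : ∀ m u v, c (z • m) u v =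
    if 0 < u ∧ 0 < v ∧ u ≤ d ∧ v < d then c m (u - 1) (v - 1) else 0

/-! ### Solving the boundary equations of a staircase module in degree one -/

section

variable {K : Type u} [Field K]

/-- For v ≤ u the variable y contributes nothing, and what remains, fx(u,v) = -fz(u,v-1), is
`hcycle` at (u+1,v), or `h1` on the edge u = d. For u < v the witnesses are made to fit, except at
(0,1): z does not reach it, and `h3`, the vanishing of the xy-coefficient, is needed. -/
theorem staircase_boundary_x {d : ℕ} {fx fy fz : ℕ → ℕ → K}
    (hcycle : ∀ u v, (if v < u ∧ u ≤ d ∧ v < d then fx (u - 1) v else 0) +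
        (if u < v ∧ v < d then fy u (v - 1) else 0) +
        (if 0 < u ∧ 0 < v ∧ u ≤ d ∧ v < d then fz (u - 1) (v - 1) else 0) = 0)
    (h1 : ∀ v, v < d → fx d v + (if 0 < v then fz d (v - 1) else 0) = 0)
    (h3 : fy 1 0 + fx 0 1 = 0)
    (hs : ∀ u v, ¬ (u ≤ d ∧ v < d) → fx u v = 0) (u v : ℕ) :
    -(if u < v ∧ v < d then
        if u ≤ d ∧ v - 1 < d then
          if v - 1 ≤ u then fy (u + 1) (v - 1) else -fx u (v - 1 + 1) else 0 else 0) -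
      (if 0 < u ∧ 0 < v ∧ u ≤ d ∧ v < d then
        if u - 1 ≤ d ∧ v - 1 < d then
          if v - 1 ≤ u - 1 then fz (u - 1 + 1) (v - 1)
          else if v - 1 = u - 1 + 1 then - fx (u - 1 + 1) (u - 1 + 2) - fy (u - 1 + 2) (u - 1 + 1)
            else 0 else 0 else 0) = fx u v := by
  by_cases hQ : u ≤ d ∧ v < d
  swap
  · rw [hs u v hQ, if_neg (by omega), if_neg (by omega)]
    simp
  obtain ⟨hu, hv⟩ := hQ
  rcases lt_or_ge u v with huv | huv
  · obtain ⟨v, rfl⟩ : ∃ w, v = w + 1 := ⟨v - 1, by omega⟩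
    simp only [Nat.add_sub_cancel]
    rw [if_pos ⟨huv, hv⟩, if_pos (by omega)]
    rcases Nat.eq_zero_or_pos u with rfl | hu0
    · rw [if_neg (c := 0 < 0 ∧ _) (by omega)]
      rcases Nat.eq_zero_or_pos v with rfl | hv0
      · simp only [le_refl, if_true, zero_add, sub_zero]
        linear_combination -h3
      · rw [if_neg (by omega)]
        simp
    · obtain ⟨u, rfl⟩ : ∃ w, u = w + 1 := ⟨u - 1, by omega⟩
      simp only [Nat.add_sub_cancel]
      rw [if_pos (c := 0 < u + 1 ∧ _) (by omega), if_pos (c := u ≤ d ∧ _) (by omega),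
        if_neg (c := v ≤ u) (by omega)]
      rcases eq_or_ne v (u + 1) with rfl | hne
      · rw [if_pos le_rfl, if_pos rfl]
        ring
      · rw [if_neg (by omega), if_neg hne]
        ring
  · rw [if_neg (by omega)]
    rcases Nat.eq_zero_or_pos v with rfl | hv0
    · rw [if_neg (by omega)]
      rcases Nat.lt_or_ge u d with hud | hud
      · have := hcycle (u + 1) 0
        rw [if_pos (by omega), if_neg (by omega), if_neg (by omega)] at this
        simp only [Nat.add_sub_cancel, add_zero] at this
        simp [this]
      · obtain rfl : u = d := by omega
        have := h1 0 hv
        rw [if_neg (by omega), add_zero] at this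
        simp [this]
    · obtain ⟨v, rfl⟩ : ∃ w, v = w + 1 := ⟨v - 1, by omega⟩
      obtain ⟨u, rfl⟩ : ∃ w, u = w + 1 := ⟨u - 1, by omega⟩
      simp only [Nat.add_sub_cancel]
      rw [if_pos (by omega), if_pos (by omega), if_pos (by omega)]
      rcases Nat.lt_or_ge (u + 1) d with hud | hud
      · have := hcycle (u + 2) (v + 1)
        rw [if_pos (by omega), if_neg (by omega), if_pos (by omega)] at this
        simp only [show u + 2 - 1 = u + 1 from rfl, Nat.add_sub_cancel] at this
        linear_combination -this
      · obtain rfl : u + 1 = d := by omega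
        have := h1 (v + 1) hv
        rw [if_pos (by omega), Nat.add_sub_cancel] at this
        linear_combination -this

/-- For v < u the term x·gxy already equals fy. For u ≤ v what remains, fy(u,v) = -fz(u-1,v), is
`hcycle` at (u,v+1), or `h2` on the edge v = d-1. -/
theorem staircase_boundary_y {d : ℕ} {fx fy fz : ℕ → ℕ → K}
    (hcycle : ∀ u v, (if v < u ∧ u ≤ d ∧ v < d then fx (u - 1) v else 0) +
        (if u < v ∧ v < d then fy u (v - 1) else 0) +
        (if 0 < u ∧ 0 < v ∧ u ≤ d ∧ v < d then fz (u - 1) (v - 1) else 0) = 0)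
    (h2 : ∀ u, u < d + 1 → (if u < d then fy u (d - 1) else 0) +
          (if 0 < u then fz (u - 1) (d - 1) else 0) = 0)
    (hs : ∀ u v, ¬ (u ≤ d ∧ v < d) → fy u v = 0) (u v : ℕ) :
    (if v < u ∧ u ≤ d ∧ v < d then
        if u - 1 ≤ d ∧ v < d then
          if v ≤ u - 1 then fy (u - 1 + 1) v else -fx (u - 1) (v + 1) else 0 else 0) -
      (if 0 < u ∧ 0 < v ∧ u ≤ d ∧ v < d then
        if u - 1 ≤ d ∧ v - 1 < d then
          if u - 1 ≤ v - 1 then fz (u - 1) (v - 1 + 1) else 0 else 0 else 0) = fy u v := by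
  by_cases hQ : u ≤ d ∧ v < d
  swap
  · rw [hs u v hQ, if_neg (by omega), if_neg (by omega)]
    simp
  obtain ⟨hu, hv⟩ := hQ
  rcases lt_or_ge v u with huv | huv
  · obtain ⟨u, rfl⟩ : ∃ w, u = w + 1 := ⟨u - 1, by omega⟩
    simp only [Nat.add_sub_cancel]
    rw [if_pos (by omega), if_pos (by omega), if_pos (by omega)]
    rw [show (if 0 < u + 1 ∧ 0 < v ∧ u + 1 ≤ d ∧ v < d then
        if u ≤ d ∧ v - 1 < d then
          if u ≤ v - 1 then fz u (v - 1 + 1) else 0 else 0 else 0) = 0 by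
      rcases Nat.eq_zero_or_pos v with rfl | hv0
      · rw [if_neg (by omega)]
      · rw [if_neg (c := u ≤ v - 1) (by omega)]
        simp]
    ring
  · rw [if_neg (by omega)]
    rcases Nat.lt_or_ge (v + 1) d with hvd | hvd
    · have := hcycle u (v + 1)
      rw [if_neg (by omega), if_pos (by omega)] at this
      simp only [Nat.add_sub_cancel] at this
      rcases Nat.eq_zero_or_pos u with rfl | hu0
      · rw [if_neg (by omega)] at this ⊢
        linear_combination -this
      · rw [if_pos (by omega)] at this ⊢
        rw [if_pos (by omega), if_pos (by omega), Nat.sub_add_cancel (by omega)]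
        linear_combination -this
    · obtain rfl : d = v + 1 := by omega
      have := h2 u (by omega)
      rw [if_pos (by omega), Nat.add_sub_cancel] at this
      rcases Nat.eq_zero_or_pos u with rfl | hu0
      · rw [if_neg (by omega)] at this ⊢
        linear_combination -this
      · rw [if_pos (by omega)] at this ⊢
        rw [if_pos (by omega), if_pos (by omega), Nat.sub_add_cancel (by omega)]
        linear_combination -this

/-- Off the diagonal the witnesses reproduce fz. On it neither x nor y contributes, so fz(u,u) must
vanish: this is `hcycle` at (u+1,u+1), where only z arrives, or `h2` at the corner. -/
theorem staircase_boundary_z {d : ℕ} {fx fy fz : ℕ → ℕ → K}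
    (hcycle : ∀ u v, (if v < u ∧ u ≤ d ∧ v < d then fx (u - 1) v else 0) +
        (if u < v ∧ v < d then fy u (v - 1) else 0) +
        (if 0 < u ∧ 0 < v ∧ u ≤ d ∧ v < d then fz (u - 1) (v - 1) else 0) = 0)
    (h2 : ∀ u, u < d + 1 → (if u < d then fy u (d - 1) else 0) +
          (if 0 < u then fz (u - 1) (d - 1) else 0) = 0)
    (hs : ∀ u v, ¬ (u ≤ d ∧ v < d) → fz u v = 0) (u v : ℕ) :
    (if v < u ∧ u ≤ d ∧ v < d then
        if u - 1 ≤ d ∧ v < d then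
          if v ≤ u - 1 then fz (u - 1 + 1) v
          else if v = u - 1 + 1 then - fx (u - 1 + 1) (u - 1 + 2) - fy (u - 1 + 2) (u - 1 + 1)
            else 0 else 0 else 0) +
      (if u < v ∧ v < d then
        if u ≤ d ∧ v - 1 < d then
          if u ≤ v - 1 then fz u (v - 1 + 1) else 0 else 0 else 0) = fz u v := by
  by_cases hQ : u ≤ d ∧ v < d
  swap
  · rw [hs u v hQ, if_neg (by omega), if_neg (by omega)]
    simp
  obtain ⟨hu, hv⟩ := hQ
  rcases lt_trichotomy u v with huv | rfl | huv
  · rw [if_neg (by omega), if_pos (by omega), if_pos (by omega), if_pos (by omega),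
      Nat.sub_add_cancel (by omega), zero_add]
  · rw [if_neg (by omega), if_neg (by omega)]
    rcases Nat.lt_or_ge (u + 1) d with hud | hud
    · have := hcycle (u + 1) (u + 1)
      rw [if_neg (by omega), if_neg (by omega), if_pos (by omega), Nat.add_sub_cancel] at this
      linear_combination -this
    · obtain rfl : d = u + 1 := by omega
      have := h2 (u + 1) (by omega)
      rw [if_neg (by omega), if_pos (by omega), Nat.add_sub_cancel] at this
      linear_combination -this
  · rw [if_pos (by omega), if_pos (by omega), if_pos (by omega), if_neg (by omega),
      Nat.sub_add_cancel (by omega), add_zero]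

end

/-! ### The Koszul homology groups of a staircase module -/

namespace IsStaircase

variable {K R V : Type u} [Field K] [CommRing R] [AddCommGroup V] [Module R V]
  [Module K V] {d : ℕ} {x y z : R} {c : V →ₗ[K] (ℕ → ℕ → K)}

theorem exists_of_fun (h : IsStaircase d x y z c) (F : ℕ → ℕ → K) :
    ∃ m, ∀ u v, c m u v = if u ≤ d ∧ v < d then F u v else 0 := by
  obtain ⟨m, hm⟩ := h.exists_eq (fun u v => if u ≤ d ∧ v < d then F u v else 0)
    (fun u v huv => if_neg huv)
  exact ⟨m, fun u v => by rw [hm]⟩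

theorem finiteDimensional (h : IsStaircase d x y z c) : FiniteDimensional K V := by
  let e : V →ₗ[K] (Fin (d + 1) × Fin d → K) :=
    { toFun := fun m p => c m p.1 p.2
      map_add' := fun m m' => by ext; simp
      map_smul' := fun r m => by ext; simp }
  refine FiniteDimensional.of_injective e fun m m' hm => h.injective ?_
  funext u v
  by_cases huv : u ≤ d ∧ v < d
  · exact congrFun hm (⟨u, by omega⟩, ⟨v, huv.2⟩)
  · rw [h.supported m u v huv, h.supported m' u v huv]

variable (d x y z c) in
/-- The coefficients of `x f_x + y f_y + z f_z` at the minimal relations of a staircase module. -/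
def relationCoeff :
    ((koszul [x, y, z]).idx 1 → V) →ₗ[K] (Fin d → K) × (Fin (d + 1) → K) × K where
  toFun f :=
    (fun v => c (f (.inr ())) d v +
        if 0 < (v : ℕ) then c (f (.inl (.inl (.inr ())))) d (v - 1) else 0,
      fun u => (if (u : ℕ) < d then c (f (.inl (.inr ()))) u (d - 1) else 0) +
        if 0 < (u : ℕ) then c (f (.inl (.inl (.inr ())))) (u - 1) (d - 1) else 0,
      c (f (.inl (.inr ()))) 1 0 + c (f (.inr ())) 0 1)
  map_add' f g := by
    refine Prod.ext (funext fun v => ?_) (Prod.ext (funext fun u => ?_) ?_)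
    · simp only [Pi.add_apply, map_add, Prod.fst_add]
      split_ifs <;> ring
    · simp only [Pi.add_apply, map_add, Prod.fst_add, Prod.snd_add]
      split_ifs <;> ring
    · simp only [Pi.add_apply, map_add, Prod.snd_add]
      ring
  map_smul' r f := by
    refine Prod.ext (funext fun v => ?_) (Prod.ext (funext fun u => ?_) ?_)
    · simp only [Pi.smul_apply, map_smul, Prod.smul_fst, smul_eq_mul, RingHom.id_apply]
      split_ifs <;> ring
    · simp only [Pi.smul_apply, map_smul, Prod.smul_fst, Prod.smul_snd, smul_eq_mul,
        RingHom.id_apply]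
      split_ifs <;> ring
    · simp only [Pi.smul_apply, map_smul, Prod.smul_snd, smul_eq_mul, RingHom.id_apply]
      ring

omit [Module R V] in
theorem relationCoeff_fst (fx fy fz : V) (v : Fin d) :
    (relationCoeff d x y z c (deg1 x y z fx fy fz)).1 v =
      c fx d v + if 0 < (v : ℕ) then c fz d (v - 1) else 0 := rfl

omit [Module R V] in
theorem relationCoeff_snd_fst (fx fy fz : V) (u : Fin (d + 1)) :
    (relationCoeff d x y z c (deg1 x y z fx fy fz)).2.1 u =
      (if (u : ℕ) < d then c fy u (d - 1) else 0) +
        if 0 < (u : ℕ) then c fz (u - 1) (d - 1) else 0 := rfl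

omit [Module R V] in
theorem relationCoeff_snd_snd (fx fy fz : V) :
    (relationCoeff d x y z c (deg1 x y z fx fy fz)).2.2 = c fy 1 0 + c fx 0 1 := rfl

theorem deg1_mem_cycles (fx fy fz : V) :
    deg1 x y z fx fy fz ∈ (koszul [x, y, z]).cycles V 1 ↔ x • fx + y • fy + z • fz = 0 := by
  change (koszul [x, y, z]).d V 0 _ = 0 ↔ _
  rw [koszul_d_zero]
  exact ⟨fun hw => congrFun hw (), fun hw => funext fun _ => hw⟩

/-- Every generator of J is a variable times a monomial that is nonzero in V, which yields a cycle
for each coefficient separately. -/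
theorem exists_relationCoeff_eq (h : IsStaircase d x y z c) (hd : 2 ≤ d)
    (w : (Fin d → K) × (Fin (d + 1) → K) × K) :
    ∃ f ∈ (koszul [x, y, z]).cycles V 1, relationCoeff d x y z c f = w := by
  obtain ⟨α, β, γ⟩ := w
  -- The relations x^(d+1-v) z^v and xy are written as x times positions (d,v) and (0,1), the
  -- relations y^(d-u) z^u with u < d as y times (u,d-1), and z^d as z times (d-1,d-1). Position
  -- (0,1) exists because d ≥ 2.
  obtain ⟨fx, hfx⟩ := h.exists_of_fun fun u v =>
    if u = d then (if hv : v < d then α ⟨v, hv⟩ else 0)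
    else if u = 0 ∧ v = 1 then γ else 0
  obtain ⟨fy, hfy⟩ := h.exists_of_fun fun u v =>
    if v = d - 1 then (if hu : u < d then β ⟨u, by omega⟩ else 0) else 0
  obtain ⟨fz, hfz⟩ := h.exists_of_fun fun u v =>
    if u = d - 1 ∧ v = d - 1 then β ⟨d, by omega⟩ else 0
  refine ⟨deg1 x y z fx fy fz, (deg1_mem_cycles _ _ _).2 ?_, ?_⟩
  · refine h.injective ?_
    funext u v
    simp only [map_add, Pi.add_apply, h.x_smul, h.y_smul, h.z_smul, hfx, hfy, hfz, map_zero,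
      Pi.zero_apply]
    grind
  · refine Prod.ext (funext fun v => ?_) (Prod.ext (funext fun u => ?_) ?_)
    · rw [relationCoeff_fst]
      simp only [hfx, hfz]
      have := v.2
      clear hfx hfy hfz h
      grind
    · rw [relationCoeff_snd_fst]
      simp only [hfy, hfz]
      have := u.2
      clear hfx hfy hfz h
      grind
    · rw [relationCoeff_snd_snd]
      simp only [hfx, hfy]
      clear hfx hfy hfz h
      grind

/-- A cycle that involves no minimal relation is a combination of the Koszul relations, with
coefficients that can be written down. -/
theorem mem_boundaries_of_relationCoeff_eq_zero (h : IsStaircase d x y z c)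
    (f : (koszul [x, y, z]).idx 1 → V) (hf : f ∈ (koszul [x, y, z]).cycles V 1)
    (h0 : relationCoeff d x y z c f = 0) : f ∈ (koszul [x, y, z]).boundaries V 1 := by
  rw [eq_deg1 f] at hf h0 ⊢
  generalize f (.inr ()) = fx at hf h0 ⊢
  generalize f (.inl (.inr ())) = fy at hf h0 ⊢
  generalize f (.inl (.inl (.inr ()))) = fz at hf h0 ⊢
  have hcycle : ∀ u v, (if v < u ∧ u ≤ d ∧ v < d then c fx (u - 1) v else 0) +
      (if u < v ∧ v < d then c fy u (v - 1) else 0) +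
      (if 0 < u ∧ 0 < v ∧ u ≤ d ∧ v < d then c fz (u - 1) (v - 1) else 0) = 0 := by
    intro u v
    have := congrArg (fun m => c m u v) ((deg1_mem_cycles _ _ _).1 hf)
    simpa only [map_add, Pi.add_apply, h.x_smul, h.y_smul, h.z_smul, map_zero,
      Pi.zero_apply] using this
  have h1 : ∀ v, v < d → c fx d v + (if 0 < v then c fz d (v - 1) else 0) = 0 :=
    fun v hv => congrFun (congrArg Prod.fst h0) ⟨v, hv⟩
  have h2 : ∀ u, u < d + 1 → (if u < d then c fy u (d - 1) else 0) +
        (if 0 < u then c fz (u - 1) (d - 1) else 0) = 0 :=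
    fun u hu => congrFun (congrArg (fun p => p.2.1) h0) ⟨u, hu⟩
  have h3 : c fy 1 0 + c fx 0 1 = 0 := congrArg (fun p => p.2.2) h0
  -- Since x sees only v ≤ u and y only u ≤ v, gxy is read off from fy below the diagonal and from
  -- fx above it. The diagonal is seen by both and is given to fy. The resulting error in the
  -- x-component sits at the positions (u+1,u+2) and is absorbed through z by gxz on the line v =
  -- u+1, which x does not see.
  obtain ⟨gxy, hxy⟩ := h.exists_of_fun fun u v =>
    if v ≤ u then c fy (u + 1) v else - c fx u (v + 1)
  obtain ⟨gxz, hxz⟩ := h.exists_of_fun fun u v =>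
    if v ≤ u then c fz (u + 1) v else
      if v = u + 1 then - c fx (u + 1) (u + 2) - c fy (u + 2) (u + 1) else 0
  obtain ⟨gyz, hyz⟩ := h.exists_of_fun fun u v => if u ≤ v then c fz u (v + 1) else 0
  refine ⟨deg2 x y z gxy gxz gyz, ?_⟩
  rw [koszul_d_one]
  congr 1
  · refine h.injective (funext fun u => funext fun v => ?_)
    simp only [map_sub, map_neg, Pi.sub_apply, Pi.neg_apply, h.y_smul, h.z_smul, hxy, hxz]
    exact staircase_boundary_x hcycle h1 h3 (h.supported fx) u v
  · refine h.injective (funext fun u => funext fun v => ?_)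
    simp only [map_sub, Pi.sub_apply, h.x_smul, h.z_smul, hxy, hyz]
    exact staircase_boundary_y hcycle h2 (h.supported fy) u v
  · refine h.injective (funext fun u => funext fun v => ?_)
    simp only [map_add, Pi.add_apply, h.x_smul, h.y_smul, hxz, hyz]
    exact staircase_boundary_z hcycle h2 (h.supported fz) u v

theorem relationCoeff_eq_zero (h : IsStaircase d x y z c) (hd : 2 ≤ d)
    (f : (koszul [x, y, z]).idx 1 → V) (hf : f ∈ (koszul [x, y, z]).boundaries V 1) :
    relationCoeff d x y z c f = 0 := by
  obtain ⟨g, rfl⟩ := hf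
  rw [eq_deg2 g, koszul_d_one]
  generalize g (.inr (.inr ())) = gxy
  generalize g (.inr (.inl (.inr ()))) = gxz
  generalize g (.inl (.inr (.inr ()))) = gyz
  refine Prod.ext (funext fun v => ?_) (Prod.ext (funext fun u => ?_) ?_)
  · rw [relationCoeff_fst]
    simp only [map_add, map_sub, map_neg, Pi.add_apply, Pi.sub_apply, Pi.neg_apply, h.x_smul,
      h.y_smul, h.z_smul]
    have := v.2
    change _ = (0 : K)
    grind
  · rw [relationCoeff_snd_fst]
    simp only [map_add, map_sub, Pi.add_apply, Pi.sub_apply, h.x_smul,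
      h.y_smul, h.z_smul]
    have := u.2
    change _ = (0 : K)
    grind
  · rw [relationCoeff_snd_snd]
    simp only [map_sub, map_neg, Pi.sub_apply, Pi.neg_apply, h.x_smul,
      h.y_smul, h.z_smul]
    change _ = (0 : K)
    grind

variable [Algebra K R] [IsScalarTower K R V]

/-- V is generated by its basis vector at (0,0), and the variables generate the span of all the
others. -/
theorem rank_homology_zero (h : IsStaircase d x y z c) (hd : 1 ≤ d) :
    Module.rank K ((koszul [x, y, z]).homology V 0) = 1 := by
  let Φ : ((koszul [x, y, z]).idx 0 → V) →ₗ[K] K :=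
    { toFun := fun f => c (f ()) 0 0
      map_add' := fun f g => by simp
      map_smul' := fun r f => by simp }
  rw [rank_homology_eq (koszul [x, y, z]) 0 Φ, Module.rank_self]
  · intro r
    obtain ⟨m, hm⟩ := h.exists_of_fun fun _ _ => r
    exact ⟨fun _ => m, trivial, by simp [Φ, hm]; omega⟩
  · intro f _ hf
    have hf : c (f ()) 0 0 = 0 := hf
    -- Each position other than (0,0) is reached by exactly one of these: x if v < u, y if u < v, z
    -- on the diagonal.
    obtain ⟨fx, hfx⟩ := h.exists_of_fun fun u v => if v ≤ u then c (f ()) (u + 1) v else 0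
    obtain ⟨fy, hfy⟩ := h.exists_of_fun fun u v => if u ≤ v then c (f ()) u (v + 1) else 0
    obtain ⟨fz, hfz⟩ := h.exists_of_fun fun u v =>
      if u = v then c (f ()) (u + 1) (v + 1) else 0
    refine ⟨deg1 x y z fx fy fz, ?_⟩
    rw [koszul_d_zero]
    funext i
    refine h.injective ?_
    funext u v
    have hs := h.supported (f ()) u v
    change c (x • fx + y • fy + z • fz) u v = c (f ()) u v
    simp only [map_add, Pi.add_apply, h.x_smul, h.y_smul, h.z_smul, hfx, hfy, hfz]
    grind
  · rintro _ ⟨g, rfl⟩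
    rw [eq_deg1 g, koszul_d_zero]
    change c (_ + _ + _) 0 0 = 0
    simp [h.x_smul, h.y_smul, h.z_smul]

/-- H_3 is the socle of V, spanned by the positions (d,v) with v < d and (u,d-1) with u < d-1. The
corner (d-1,d-1) is excluded because x carries it to (d,d-1). -/
theorem rank_homology_three (h : IsStaircase d x y z c) (hd : 1 ≤ d) :
    Module.rank K ((koszul [x, y, z]).homology V 3) = ((2 * d - 1 : ℕ) : Cardinal) := by
  let Φ : ((koszul [x, y, z]).idx 3 → V) →ₗ[K] (Fin d → K) × (Fin (d - 1) → K) :=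
    { toFun := fun f => (fun v => c (f (.inr (.inr (.inr ())))) d v,
        fun u => c (f (.inr (.inr (.inr ())))) u (d - 1))
      map_add' := fun f g => by ext <;> simp
      map_smul' := fun r f => by ext <;> simp }
  have hcyc : ∀ w, deg3 x y z w ∈ (koszul [x, y, z]).cycles V 3 ↔
      x • w = 0 ∧ y • w = 0 ∧ z • w = 0 := by
    intro w
    change (koszul [x, y, z]).d V 2 _ = 0 ↔ _
    rw [koszul_d_two]
    constructor
    · intro hw
      exact ⟨congrFun hw (.inl (.inr (.inr ()))),
        neg_eq_zero.1 (congrFun hw (.inr (.inl (.inr ())))), congrFun hw (.inr (.inr ()))⟩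
    · rintro ⟨h1, h2, h3⟩
      rw [h1, h2, h3]
      funext i
      rw [eq_deg2 (0 : (koszul [x, y, z]).idx 2 → V), neg_zero]
      rfl
  rw [rank_homology_eq (koszul [x, y, z]) 3 Φ]
  · rw [← Module.finrank_eq_rank]
    congr 1
    simp
    omega
  · rintro ⟨α, β⟩
    obtain ⟨w, hw⟩ := h.exists_of_fun fun u v =>
      if u = d then (if hv : v < d then α ⟨v, hv⟩ else 0)
      else if v = d - 1 then (if hu : u < d - 1 then β ⟨u, hu⟩ else 0) else 0
    refine ⟨deg3 x y z w, (hcyc w).2 ⟨?_, ?_, ?_⟩, ?_⟩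
    · refine h.injective ?_
      funext u v
      simp only [h.x_smul, hw, map_zero, Pi.zero_apply]
      grind
    · refine h.injective ?_
      funext u v
      simp only [h.y_smul, hw, map_zero, Pi.zero_apply]
      grind
    · refine h.injective ?_
      funext u v
      simp only [h.z_smul, hw, map_zero, Pi.zero_apply]
      grind
    · refine Prod.ext (funext fun v => ?_) (funext fun u => ?_)
      · change c w d v = α v
        simp [hw]
      · change c w u (d - 1) = β u
        have h1 : (u : ℕ) ≠ d := by omega
        have h2 : (u : ℕ) ≤ d := by omega
        simp [hw, h1, h2]
        omega
  · intro f hf h0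
    rw [eq_deg3 f] at hf h0 ⊢
    generalize f (.inr (.inr (.inr ()))) = w at hf h0 ⊢
    obtain ⟨hx, hy, hz⟩ := (hcyc w).1 hf
    have h1 : ∀ v, v < d → c w d v = 0 := fun v hv => congrFun (congrArg Prod.fst h0) ⟨v, hv⟩
    have h2 : ∀ u, u < d - 1 → c w u (d - 1) = 0 :=
      fun u hu => congrFun (congrArg Prod.snd h0) ⟨u, hu⟩
    have hw : w = 0 := by
      refine h.injective ?_
      funext u v
      -- Away from the edges u = d and v = d-1, z moves a coefficient to a valid position; x does so
      -- at the corner (d-1,d-1). The other edge positions are covered by `h1` and `h2`.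
      have hx' := h.x_smul w (u + 1) v
      have hy' := h.y_smul w u (v + 1)
      have hz' := h.z_smul w (u + 1) (v + 1)
      have hs := h.supported w u v
      have h1' := h1 v
      have h2' := h2 u
      rw [hx] at hx'
      rw [hy] at hy'
      rw [hz] at hz'
      simp only [map_zero, Pi.zero_apply, Nat.add_sub_cancel] at hx' hy' hz' ⊢
      grind
    rw [hw]
    refine ⟨0, ?_⟩
    rw [map_zero, eq_deg3 (0 : (koszul [x, y, z]).idx 3 → V)]
    rfl
  · rintro _ ⟨g, rfl⟩
    -- Degree four of a Koszul complex on three elements has an empty index type.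
    have : g = 0 := by
      funext i
      rcases i with (((i | i) | (i | i)) | ((i | i) | (i | i))) | (((i | i) | (i | i)) | ((i | i) | i))
      all_goals exact i.elim
    rw [this, map_zero, map_zero]

theorem homology_subsingleton (n : ℕ) : Subsingleton ((koszul [x, y, z]).homology V (n + 4)) := by
  have : IsEmpty ((koszul [x, y, z]).idx (n + 4)) := by
    refine ⟨fun i => ?_⟩
    rcases i with (((i | i) | (i | i)) | ((i | i) | (i | i)))
    all_goals exact i.elim
  infer_instance

theorem rank_homology_one (h : IsStaircase d x y z c) (hd : 2 ≤ d) :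
    Module.rank K ((koszul [x, y, z]).homology V 1) = ((2 * d + 2 : ℕ) : Cardinal) := by
  rw [rank_homology_eq (koszul [x, y, z]) 1 (relationCoeff d x y z c)
    (h.exists_relationCoeff_eq hd) h.mem_boundaries_of_relationCoeff_eq_zero
    (h.relationCoeff_eq_zero hd), ← Module.finrank_eq_rank]
  congr 1
  simp
  omega

/-- The Koszul homology of a staircase module has dimensions `1, 2d + 2, 4d, 2d - 1`. -/
theorem rank_homology (h : IsStaircase d x y z c) (hd : 2 ≤ d) (i : ℕ) :
    Module.rank K ((koszul [x, y, z]).homology V i) =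
      (([1, 2 * d + 2, 4 * d, 2 * d - 1].getD i 0 : ℕ) : Cardinal.{u}) := by
  have := h.finiteDimensional
  match i with
  | 0 => exact (h.rank_homology_zero (by omega)).trans (by simp)
  | 1 => exact h.rank_homology_one hd
  | 3 => exact h.rank_homology_three (by omega)
  | n + 4 =>
    have := homology_subsingleton (V := V) (x := x) (y := y) (z := z) n
    simp
  | 2 =>
    -- Rank-nullity in every degree says that the Euler characteristic of homology is that of the
    -- complex, (1-3+3-1) dim V = 0. This determines H_2 from the other groups.
    let C := koszul [x, y, z]
    have h0 : Module.finrank K (C.homology V 0) = 1 :=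
      Module.finrank_eq_of_rank_eq ((h.rank_homology_zero (by omega)).trans (by simp))
    have h1 : Module.finrank K (C.homology V 1) = 2 * d + 2 :=
      Module.finrank_eq_of_rank_eq (h.rank_homology_one hd)
    have h3 : Module.finrank K (C.homology V 3) = 2 * d - 1 :=
      Module.finrank_eq_of_rank_eq (h.rank_homology_three (by omega))
    have c0 : Fintype.card (C.idx 0) = 1 := rfl
    have c1 : Fintype.card (C.idx 1) = 3 := rfl
    have c2 : Fintype.card (C.idx 2) = 3 := rfl
    have c3 : Fintype.card (C.idx 3) = 1 := rfl
    have c4 : Fintype.card (C.idx 4) = 0 := rfl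
    have a0 := C.finrank_homology_add_finrank_boundaries (K := K) (V := V) 0
    have a1 := C.finrank_homology_add_finrank_boundaries (K := K) (V := V) 1
    have a2 := C.finrank_homology_add_finrank_boundaries (K := K) (V := V) 2
    have a3 := C.finrank_homology_add_finrank_boundaries (K := K) (V := V) 3
    have z0 := C.finrank_cycles_zero (K := K) (V := V)
    have b0 : Module.finrank K (C.cycles V 1) + _ = _ :=
      C.finrank_cycles_succ_add_finrank_boundaries (K := K) (V := V) 0
    have b1 : Module.finrank K (C.cycles V 2) + _ = _ :=
      C.finrank_cycles_succ_add_finrank_boundaries (K := K) (V := V) 1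
    have b2 : Module.finrank K (C.cycles V 3) + _ = _ :=
      C.finrank_cycles_succ_add_finrank_boundaries (K := K) (V := V) 2
    have b3 := C.finrank_cycles_succ_add_finrank_boundaries (K := K) (V := V) 3
    rw [c0] at z0
    rw [zero_add, c1] at b0
    rw [one_add_one_eq_two, c2] at b1
    rw [show 2 + 1 = 3 from rfl, c3] at b2
    rw [show 3 + 1 = 4 from rfl, c4] at b3
    have : Module.finrank K (C.homology V 2) = 4 * d := by
      omega
    have hfin := C.finiteDimensional_homology (K := K) (V := V) 2
    exact (Module.finrank_eq_rank K (C.homology V 2)).symm.trans (congrArg Nat.cast this)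

end IsStaircase

end

noncomputable section

/-! ### Betti numbers from a monomial basis -/

/-- The triples `(n, u, v)` with `u, v ≤ n`, `u ≤ d` and `v < d`. -/
def normalForms (d : ℕ) : Set (ℕ × ℕ × ℕ) :=
  {t | t.2.1 ≤ d ∧ t.2.2 < d ∧ t.2.1 ≤ t.1 ∧ t.2.2 ≤ t.1}

/-- A basis `b (n, u, v)` of the `K[x₀, …, x₃]`-algebra `A`, indexed by normal forms, on which
`x₀`, `x₁`, `x₂`, `x₃` act by shifting by `(1, 0, 0)`, `(1, 1, 0)`, `(1, 0, 1)`, `(1, 1, 1)`, up to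
multiples of `x₀` when the result is not a normal form. -/
structure IsMonomialBasis {K A : Type u} [Field K] [CommRing A] [Module K A] (d : ℕ)
    (φ : MvPolynomial (Fin 4) K →+* A) (b : ℕ × ℕ × ℕ → A)
    (B : Module.Basis (normalForms d) K A) : Prop where
  smul_eq : ∀ (r : K) (a : A), r • a = φ (MvPolynomial.C r) * a
  basis_apply : ∀ t, B t = b t
  x₀_mul : ∀ n u v, (n, u, v) ∈ normalForms d →
    φ (MvPolynomial.X 0) * b (n, u, v) = b (n + 1, u, v)
  x₁_mul : ∀ n u v, (n, u, v) ∈ normalForms d → u < d →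
    φ (MvPolynomial.X 1) * b (n, u, v) = b (n + 1, u + 1, v)
  x₁_mul_mem : ∀ n u v, (n, u, v) ∈ normalForms d → u = d →
    φ (MvPolynomial.X 0) ∣ φ (MvPolynomial.X 1) * b (n, u, v)
  x₂_mul : ∀ n u v, (n, u, v) ∈ normalForms d → v + 1 < d →
    φ (MvPolynomial.X 2) * b (n, u, v) = b (n + 1, u, v + 1)
  x₂_mul_mem : ∀ n u v, (n, u, v) ∈ normalForms d → v + 1 = d →
    φ (MvPolynomial.X 0) ∣ φ (MvPolynomial.X 2) * b (n, u, v)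
  x₃_mul : ∀ n u v, (n, u, v) ∈ normalForms d → u < d → v + 1 < d →
    φ (MvPolynomial.X 3) * b (n, u, v) = b (n + 1, u + 1, v + 1)
  x₃_mul_mem : ∀ n u v, (n, u, v) ∈ normalForms d → u = d ∨ v + 1 = d →
    φ (MvPolynomial.X 0) ∣ φ (MvPolynomial.X 3) * b (n, u, v)

namespace IsMonomialBasis

open MvPolynomial

variable {K A : Type u} [Field K] [CommRing A] [Module K A] {d : ℕ}
  {φ : MvPolynomial (Fin 4) K →+* A} {b : ℕ × ℕ × ℕ → A} {B : Module.Basis (normalForms d) K A}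

variable (d B) in
/-- The coordinates at the normal forms `(max u v, u, v)`. -/
def coord : A →ₗ[K] (ℕ → ℕ → K) where
  toFun a u v := if h : u ≤ d ∧ v < d then
    B.repr a ⟨(max u v, u, v), h.1, h.2, le_max_left _ _, le_max_right _ _⟩ else 0
  map_add' a a' := by
    ext u v
    by_cases h : u ≤ d ∧ v < d <;> simp [h]
  map_smul' r a := by
    ext u v
    by_cases h : u ≤ d ∧ v < d <;> simp [h]

theorem coord_basis (h : IsMonomialBasis d φ b B) (n u v : ℕ) (ht : (n, u, v) ∈ normalForms d)
    (u' v' : ℕ) :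
    coord d B (b (n, u, v)) u' v' = if u' = u ∧ v' = v ∧ n = max u v then 1 else 0 := by
  rw [← h.basis_apply ⟨_, ht⟩]
  obtain ⟨h1, h2, h3, h4⟩ := ht
  simp only [coord, LinearMap.coe_mk, AddHom.coe_mk, Module.Basis.repr_self, Finsupp.single_apply,
    Subtype.ext_iff, Prod.mk.injEq]
  simp only at h1 h2 h3 h4
  split_ifs <;> first | rfl | (exfalso; omega)

/-- Multiplication by the image of a polynomial, as a `K`-linear map. -/
def mulLeft (h : IsMonomialBasis d φ b B) (s : MvPolynomial (Fin 4) K) : A →ₗ[K] A where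
  toFun a := φ s * a
  map_add' := mul_add _
  map_smul' r a := by
    rw [h.smul_eq, RingHom.id_apply, h.smul_eq]
    ring

theorem coord_x₀_mul (h : IsMonomialBasis d φ b B) (a : A) : coord d B (φ (X 0) * a) = 0 := by
  have : (coord d B).comp (h.mulLeft (X 0)) = 0 := by
    refine B.ext ?_
    rintro ⟨⟨n, u, v⟩, ht⟩
    have h1 : (n + 1, u, v) ∈ normalForms d := ⟨ht.1, ht.2.1, ht.2.2.1.trans (Nat.le_succ n),
      ht.2.2.2.trans (Nat.le_succ n)⟩
    rw [h.basis_apply]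
    change coord d B (φ (X 0) * b (n, u, v)) = 0
    rw [h.x₀_mul n u v ht]
    ext u' v'
    rw [h.coord_basis _ _ _ h1]
    obtain ⟨-, -, h3, h4⟩ := ht
    simp only at h3 h4
    exact if_neg (by omega)
  exact LinearMap.congr_fun this a

theorem coord_of_dvd (h : IsMonomialBasis d φ b B) {a : A} (ha : φ (X 0) ∣ a) :
    coord d B a = 0 := by
  obtain ⟨a, rfl⟩ := ha
  exact h.coord_x₀_mul a

/-- A basis vector with n > max u v is x₀ times the one at n-1, so only the vectors with n = max u v
survive modulo x₀. -/
theorem dvd_of_coord_eq_zero (h : IsMonomialBasis d φ b B) {a : A} (ha : coord d B a = 0) :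
    φ (X 0) ∣ a := by
  rw [← B.linearCombination_repr a, Finsupp.linearCombination_apply]
  refine Finset.dvd_sum ?_
  rintro ⟨⟨n, u, v⟩, ht⟩ -
  obtain ⟨h1, h2, h3, h4⟩ := id ht
  simp only at h1 h2 h3 h4
  change _ ∣ B.repr a ⟨(n, u, v), ht⟩ • B ⟨(n, u, v), ht⟩
  rw [h.smul_eq]
  rcases eq_or_ne n (max u v) with rfl | hn
  · have : B.repr a ⟨(max u v, u, v), ht⟩ = 0 := by
      have := congrFun (congrFun ha u) v
      simpa [coord, h1, h2] using this
    rw [this]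
    simp
  · obtain ⟨m, rfl⟩ : ∃ m, n = m + 1 := ⟨n - 1, by omega⟩
    refine Dvd.dvd.mul_left ?_ _
    rw [h.basis_apply]
    have hm : (m, u, v) ∈ normalForms d := ⟨h1, h2, by simp only; omega, by simp only; omega⟩
    exact ⟨_, (h.x₀_mul m u v hm).symm⟩

/-- Multiplication by x₀ permutes the basis injectively into itself, so the coordinates of a can be
read off from those of x₀ a. -/
theorem eq_zero_of_x₀_mul (h : IsMonomialBasis d φ b B) {a : A} (ha : φ (X 0) * a = 0) : a = 0 := by
  have key : ∀ t : normalForms d, B.repr a t = B.repr (φ (X 0) * a)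
      ⟨(t.1.1 + 1, t.1.2), t.2.1, t.2.2.1, t.2.2.2.1.trans (Nat.le_succ _),
        t.2.2.2.2.trans (Nat.le_succ _)⟩ := by
    intro t
    have : B.coord t = (B.coord ⟨(t.1.1 + 1, t.1.2), t.2.1, t.2.2.1,
        t.2.2.2.1.trans (Nat.le_succ _), t.2.2.2.2.trans (Nat.le_succ _)⟩).comp
          (h.mulLeft (X 0)) := by
      refine B.ext ?_
      rintro ⟨⟨n, u, v⟩, ht⟩
      have h1 : (n + 1, u, v) ∈ normalForms d := ⟨ht.1, ht.2.1, ht.2.2.1.trans (Nat.le_succ n),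
        ht.2.2.2.trans (Nat.le_succ n)⟩
      have h2 : h.mulLeft (X 0) (B ⟨(n, u, v), ht⟩) = B ⟨_, h1⟩ := by
        rw [h.basis_apply, h.basis_apply]
        exact h.x₀_mul n u v ht
      rw [LinearMap.comp_apply, h2]
      obtain ⟨⟨n', u', v'⟩, ht'⟩ := t
      simp [Module.Basis.coord_apply, Finsupp.single_apply, Subtype.ext_iff]
    exact LinearMap.congr_fun this a
  rw [← B.repr.map_eq_zero_iff]
  ext t
  rw [key, ha, map_zero]
  rfl

/-- The product of x₁ with the vector (max u v, u, v) survives modulo x₀ iff max (u+1) v = max u v +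
1, that is, v ≤ u. In terms of the target position this reads v < u. -/
theorem coord_x₁_mul (h : IsMonomialBasis d φ b B) (a : A) (u v : ℕ) :
    coord d B (φ (X 1) * a) u v =
      if v < u ∧ u ≤ d ∧ v < d then coord d B a (u - 1) v else 0 := by
  have : (LinearMap.proj v).comp ((LinearMap.proj u).comp ((coord d B).comp (h.mulLeft (X 1)))) =
      if v < u ∧ u ≤ d ∧ v < d then
        (LinearMap.proj v).comp ((LinearMap.proj (u - 1)).comp (coord d B)) else 0 := by
    refine B.ext ?_
    rintro ⟨⟨n, u', v'⟩, ht⟩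
    rw [h.basis_apply]
    change coord d B (φ (X 1) * b (n, u', v')) u v = _
    have hR : (if v < u ∧ u ≤ d ∧ v < d then
        (LinearMap.proj v).comp ((LinearMap.proj (u - 1)).comp (coord d B)) else
          (0 : A →ₗ[K] K)) (b (n, u', v')) =
        if v < u ∧ u ≤ d ∧ v < d then coord d B (b (n, u', v')) (u - 1) v else 0 := by
      split_ifs <;> rfl
    refine Eq.trans ?_ hR.symm
    rw [h.coord_basis _ _ _ ht]
    obtain ⟨h1, h2, h3, h4⟩ := id ht
    simp only at h1 h2 h3 h4
    rcases h1.lt_or_eq with hlt | heq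
    · rw [h.x₁_mul n u' v' ht hlt, h.coord_basis _ _ _
        ⟨by simp only; omega, by simp only; omega, by simp only; omega, by simp only; omega⟩]
      split_ifs <;> first | rfl | (exfalso; omega)
    · rw [h.coord_of_dvd (h.x₁_mul_mem n u' v' ht heq)]
      split_ifs <;> first | rfl | (exfalso; omega)
  have := LinearMap.congr_fun this a
  split_ifs at this ⊢ <;> exact this

theorem coord_x₂_mul (h : IsMonomialBasis d φ b B) (a : A) (u v : ℕ) :
    coord d B (φ (X 2) * a) u v = if u < v ∧ v < d then coord d B a u (v - 1) else 0 := by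
  have : (LinearMap.proj v).comp ((LinearMap.proj u).comp ((coord d B).comp (h.mulLeft (X 2)))) =
      if u < v ∧ v < d then
        (LinearMap.proj (v - 1)).comp ((LinearMap.proj u).comp (coord d B)) else 0 := by
    refine B.ext ?_
    rintro ⟨⟨n, u', v'⟩, ht⟩
    rw [h.basis_apply]
    change coord d B (φ (X 2) * b (n, u', v')) u v = _
    have hR : (if u < v ∧ v < d then
        (LinearMap.proj (v - 1)).comp ((LinearMap.proj u).comp (coord d B)) else
          (0 : A →ₗ[K] K)) (b (n, u', v')) =
        if u < v ∧ v < d then coord d B (b (n, u', v')) u (v - 1) else 0 := by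
      split_ifs <;> rfl
    refine Eq.trans ?_ hR.symm
    rw [h.coord_basis _ _ _ ht]
    obtain ⟨h1, h2, h3, h4⟩ := id ht
    simp only at h1 h2 h3 h4
    rcases (Nat.succ_le_of_lt h2).lt_or_eq with hlt | heq
    · rw [h.x₂_mul n u' v' ht hlt, h.coord_basis _ _ _
        ⟨by simp only; omega, by simp only; omega, by simp only; omega, by simp only; omega⟩]
      split_ifs <;> first | rfl | (exfalso; omega)
    · rw [h.coord_of_dvd (h.x₂_mul_mem n u' v' ht heq)]
      split_ifs <;> first | rfl | (exfalso; omega)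
  have := LinearMap.congr_fun this a
  split_ifs at this ⊢ <;> exact this

/-- Raising u and v together always raises max u v by one, so x₃ acts on both sides of the diagonal
and dies only at the edges. -/
theorem coord_x₃_mul (h : IsMonomialBasis d φ b B) (a : A) (u v : ℕ) :
    coord d B (φ (X 3) * a) u v =
      if 0 < u ∧ 0 < v ∧ u ≤ d ∧ v < d then coord d B a (u - 1) (v - 1) else 0 := by
  have : (LinearMap.proj v).comp ((LinearMap.proj u).comp ((coord d B).comp (h.mulLeft (X 3)))) =
      if 0 < u ∧ 0 < v ∧ u ≤ d ∧ v < d then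
        (LinearMap.proj (v - 1)).comp ((LinearMap.proj (u - 1)).comp (coord d B)) else 0 := by
    refine B.ext ?_
    rintro ⟨⟨n, u', v'⟩, ht⟩
    rw [h.basis_apply]
    change coord d B (φ (X 3) * b (n, u', v')) u v = _
    have hR : (if 0 < u ∧ 0 < v ∧ u ≤ d ∧ v < d then
        (LinearMap.proj (v - 1)).comp ((LinearMap.proj (u - 1)).comp (coord d B)) else
          (0 : A →ₗ[K] K)) (b (n, u', v')) =
        if 0 < u ∧ 0 < v ∧ u ≤ d ∧ v < d then
          coord d B (b (n, u', v')) (u - 1) (v - 1) else 0 := by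
      split_ifs <;> rfl
    refine Eq.trans ?_ hR.symm
    rw [h.coord_basis _ _ _ ht]
    obtain ⟨h1, h2, h3, h4⟩ := id ht
    simp only at h1 h2 h3 h4
    by_cases hlt : u' < d ∧ v' + 1 < d
    · rw [h.x₃_mul n u' v' ht hlt.1 hlt.2, h.coord_basis _ _ _
        ⟨by simp only; omega, by simp only; omega, by simp only; omega, by simp only; omega⟩]
      split_ifs <;> first | rfl | (exfalso; omega)
    · rw [h.coord_of_dvd (h.x₃_mul_mem n u' v' ht (by omega))]
      split_ifs <;> first | rfl | (exfalso; omega)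
  have := LinearMap.congr_fun this a
  split_ifs at this ⊢ <;> exact this

theorem exists_coord_eq (h : IsMonomialBasis d φ b B) (F : ℕ → ℕ → K)
    (hF : ∀ u v, ¬ (u ≤ d ∧ v < d) → F u v = 0) : ∃ a, coord d B a = F := by
  refine ⟨∑ u ∈ Finset.range (d + 1), ∑ v ∈ Finset.range d, F u v • b (max u v, u, v), ?_⟩
  ext u v
  simp only [map_sum, map_smul, Finset.sum_apply, Pi.smul_apply, smul_eq_mul]
  have h1 : ∀ u' ∈ Finset.range (d + 1), ∀ v' ∈ Finset.range d,
      F u' v' * coord d B (b (max u' v', u', v')) u v =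
        if u' = u then (if v' = v then F u v else 0) else 0 := by
    intro u' hu' v' hv'
    rw [Finset.mem_range] at hu' hv'
    rw [h.coord_basis _ _ _ ⟨by simp only; omega, hv', le_max_left _ _, le_max_right _ _⟩]
    by_cases hu : u' = u
    · by_cases hv : v' = v
      · simp [hu, hv]
      · simp [hv, Ne.symm hv]
    · simp [hu, Ne.symm hu]
  rw [Finset.sum_congr rfl fun u' hu' => Finset.sum_congr rfl (h1 u' hu')]
  by_cases huv : u ≤ d ∧ v < d
  · rw [Finset.sum_eq_single u, Finset.sum_eq_single v]
    · simp
    · intro v' _ hv'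
      simp [hv']
    · intro hv'
      exact absurd (Finset.mem_range.2 huv.2) hv'
    · intro u' _ hu'
      simp [hu']
    · intro hu'
      exact absurd (Finset.mem_range.2 (Nat.lt_succ_of_le huv.1)) hu'
  · rw [hF u v huv]
    exact Finset.sum_eq_zero fun u' _ => Finset.sum_eq_zero fun v' _ => by simp

/-- The Betti sequence of an algebra with a monomial basis. -/
theorem hasBettiSequence (h : IsMonomialBasis d φ b B) (hd : 2 ≤ d) :
    HasBettiSequence K φ [1, 2 * d + 2, 4 * d, 2 * d - 1] := by
  let I : Ideal A := Ideal.span {φ (X 0)}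
  let φ' : MvPolynomial (Fin 4) K →+* A ⧸ I := (Ideal.Quotient.mk I).comp φ
  let _ : Module (MvPolynomial (Fin 4) K) (A ⧸ I) := Module.compHom _ φ'
  let _ : Module K (A ⧸ I) := Module.compHom _ (φ'.comp C)
  have : IsScalarTower K (MvPolynomial (Fin 4) K) (A ⧸ I) := ⟨fun r s a => by
    change φ' (r • s) * a = φ' (C r) * (φ' s * a)
    rw [MvPolynomial.smul_eq_C_mul, map_mul, mul_assoc]⟩
  have hI : ∀ a, a ∈ I ↔ φ (X 0) ∣ a := fun a => Ideal.mem_span_singleton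
  let c : (A ⧸ I) →ₗ[K] (ℕ → ℕ → K) :=
    { QuotientAddGroup.lift I.toAddSubgroup (coord d B).toAddMonoidHom
        (fun a ha => h.coord_of_dvd ((hI a).1 ha)) with
      map_smul' := fun r x => by
        obtain ⟨a, rfl⟩ := Ideal.Quotient.mk_surjective x
        change coord d B (φ (C r) * a) = r • coord d B a
        rw [← h.smul_eq, map_smul] }
  have hc : ∀ a, c (Ideal.Quotient.mk I a) = coord d B a := fun _ => rfl
  have hstair : IsStaircase d (X 1 : MvPolynomial (Fin 4) K) (X 2) (X 3) c :=
    { injective := by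
        rw [← LinearMap.ker_eq_bot, eq_bot_iff]
        intro x hx
        obtain ⟨a, rfl⟩ := Ideal.Quotient.mk_surjective x
        exact Ideal.Quotient.eq_zero_iff_mem.2 ((hI a).2 (h.dvd_of_coord_eq_zero hx))
      supported := fun x u v huv => by
        obtain ⟨a, rfl⟩ := Ideal.Quotient.mk_surjective x
        exact dif_neg huv
      exists_eq := fun F hF => by
        obtain ⟨a, ha⟩ := h.exists_coord_eq F hF
        exact ⟨Ideal.Quotient.mk I a, ha⟩
      x_smul := fun x u v => by
        obtain ⟨a, rfl⟩ := Ideal.Quotient.mk_surjective x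
        exact h.coord_x₁_mul a u v
      y_smul := fun x u v => by
        obtain ⟨a, rfl⟩ := Ideal.Quotient.mk_surjective x
        exact h.coord_x₂_mul a u v
      z_smul := fun x u v => by
        obtain ⟨a, rfl⟩ := Ideal.Quotient.mk_surjective x
        exact h.coord_x₃_mul a u v }
  intro i
  rw [bettiNumber_eq_rank φ (Ideal.Quotient.mk I).toAddMonoidHom
    (fun s a => map_mul (Ideal.Quotient.mk I) (φ s) a) Ideal.Quotient.mk_surjective
    (fun a => h.eq_zero_of_x₀_mul)
    (fun a => Ideal.Quotient.eq_zero_iff_mem.trans ((hI a).trans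
      ⟨fun ⟨b, hb⟩ => ⟨b, hb.symm⟩, fun ⟨b, hb⟩ => ⟨b, hb.symm⟩⟩)) i]
  exact hstair.rank_homology hd i

end IsMonomialBasis

end

noncomputable section

/-! ### The Bresinsky semigroup -/

/-- The degree `(d + 1) d n + d u + 2 (d + 1) v` of the triple `(n, u, v)`. -/
def tripleDeg (d n u v : ℕ) : ℕ := (d + 1) * d * n + d * u + 2 * (d + 1) * v

theorem tripleDeg_add (d n u v n' u' v' : ℕ) :
    tripleDeg d n u v + tripleDeg d n' u' v' = tripleDeg d (n + n') (u + u') (v + v') := by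
  unfold tripleDeg
  ring

theorem tripleDeg_left_wrap (d n u v : ℕ) :
    tripleDeg d n (u + (d + 1)) v = tripleDeg d (n + 1) u v := by
  unfold tripleDeg
  ring

theorem tripleDeg_right_wrap (d n u v : ℕ) :
    tripleDeg d n u (v + d) = tripleDeg d (n + 2) u v := by
  unfold tripleDeg
  ring

/-- Each trade lowers u + v, never lowers n and preserves u, v ≤ n. The bound n ≤ n' is what later
identifies n' with the 𝔪-adic order. -/
theorem exists_normalForm {d : ℕ} (hd : 1 ≤ d) (n u v : ℕ) (hu : u ≤ n) (hv : v ≤ n) :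
    ∃ n' u' v', (n', u', v') ∈ normalForms d ∧ n ≤ n' ∧
      tripleDeg d n' u' v' = tripleDeg d n u v := by
  induction h : u + v using Nat.strong_induction_on generalizing n u v with
  | _ k ih =>
    by_cases h1 : d + 1 ≤ u
    · obtain ⟨w, rfl⟩ := Nat.exists_eq_add_of_le' h1
      obtain ⟨n', u', v', h2, h3, h4⟩ :=
        ih (w + v) (by omega) (n + 1) w v (by omega) (by omega) rfl
      exact ⟨n', u', v', h2, by omega, h4.trans (tripleDeg_left_wrap d n w v).symm⟩
    by_cases h2 : d ≤ v
    · obtain ⟨w, rfl⟩ := Nat.exists_eq_add_of_le' h2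
      obtain ⟨n', u', v', h2, h3, h4⟩ :=
        ih (u + w) (by omega) (n + 2) u w (by omega) (by omega) rfl
      exact ⟨n', u', v', h2, by omega, h4.trans (tripleDeg_right_wrap d n u w).symm⟩
    exact ⟨n, u, v, ⟨by simp only; omega, by simp only; omega, hu, hv⟩, le_rfl, rfl⟩

/-- Modulo d+1 the degree is du, which determines u ≤ d. Modulo d it is 2v, which determines v < d
because d is odd; then n is determined too. -/
theorem tripleDeg_injOn {d h : ℕ} (hd : d + 1 = 2 * h) {n u v n' u' v' : ℕ} (hu : u ≤ d)
    (hv : v < d) (hu' : u' ≤ d) (hv' : v' < d)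
    (heq : tripleDeg d n u v = tripleDeg d n' u' v') : n = n' ∧ u = u' ∧ v = v' := by
  have hu1 : u = u' := by
    have h1 : d * u ≡ d * u' [MOD d + 1] := by
      have e : ∀ n u v, tripleDeg d n u v = d * u + (d + 1) * (d * n + 2 * v) := fun n u v => by
        unfold tripleDeg
        ring
      have : tripleDeg d n u v ≡ tripleDeg d n' u' v' [MOD d + 1] := by rw [heq]
      rw [e, e] at this
      simpa [Nat.ModEq] using this
    have h2 := Nat.ModEq.cancel_left_of_coprime (by simp) h1
    exact h2.eq_of_lt_of_lt (by omega) (by omega)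
  have hv1 : v = v' := by
    have h1 : 2 * v ≡ 2 * v' [MOD d] := by
      have e : ∀ n u v, tripleDeg d n u v = 2 * v + d * ((d + 1) * n + u + 2 * v) := fun n u v => by
        unfold tripleDeg
        ring
      have : tripleDeg d n u v ≡ tripleDeg d n' u' v' [MOD d] := by rw [heq]
      rw [e, e] at this
      simpa [Nat.ModEq] using this
    have hcop : Nat.gcd d 2 = 1 := by
      rw [← Nat.Coprime, Nat.coprime_two_right]
      exact ⟨h - 1, by omega⟩
    exact (Nat.ModEq.cancel_left_of_coprime hcop h1).eq_of_lt_of_lt hv hv'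
  subst hu1 hv1
  refine ⟨?_, rfl, rfl⟩
  unfold tripleDeg at heq
  have : (d + 1) * d * n = (d + 1) * d * n' := by omega
  exact Nat.eq_of_mul_eq_mul_left (Nat.mul_pos (by omega) (by omega)) this

/-- `s` is a sum of at least `i` of the degrees of `(1, 0, 0)`, `(1, 1, 0)`, `(1, 0, 1)`,
`(1, 1, 1)`. -/
def HasOrder (d i s : ℕ) : Prop := ∃ n u v, u ≤ n ∧ v ≤ n ∧ i ≤ n ∧ tripleDeg d n u v = s

theorem HasOrder.add {d i j s t : ℕ} (hs : HasOrder d i s) (ht : HasOrder d j t) :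
    HasOrder d (i + j) (s + t) := by
  obtain ⟨n, u, v, h1, h2, h3, rfl⟩ := hs
  obtain ⟨n', u', v', h1', h2', h3', rfl⟩ := ht
  exact ⟨n + n', u + u', v + v', by omega, by omega, by omega, (tripleDeg_add _ _ _ _ _ _ _).symm⟩

theorem HasOrder.mono {d i j s : ℕ} (hs : HasOrder d i s) (hij : j ≤ i) : HasOrder d j s := by
  obtain ⟨n, u, v, h1, h2, h3, rfl⟩ := hs
  exact ⟨n, u, v, h1, h2, hij.trans h3, rfl⟩

/-- Normalizing any representation with at least i summands only increases n and, by uniqueness,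
ends at the given triple. -/
theorem hasOrder_tripleDeg {d h : ℕ} (hd : d + 1 = 2 * h) {n u v i : ℕ}
    (ht : (n, u, v) ∈ normalForms d) : HasOrder d i (tripleDeg d n u v) ↔ i ≤ n := by
  constructor
  · rintro ⟨n', u', v', h1, h2, h3, h4⟩
    obtain ⟨h5, h6, h7, h8⟩ := ht
    simp only at h5 h6 h7 h8
    obtain ⟨n'', u'', v'', h9, h10, h11⟩ := exists_normalForm (d := d) (by omega) n' u' v' h1 h2
    obtain ⟨rfl, -, -⟩ := tripleDeg_injOn hd h9.1 h9.2.1 h5 h6 (h11.trans h4)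
    omega
  · intro hi
    exact ⟨n, u, v, ht.2.2.1, ht.2.2.2, hi, rfl⟩

section Bresinsky

variable {d h : ℕ}

theorem bresinsky_eq (hd : d + 1 = 2 * h) : bresinsky h =
    ![tripleDeg d 1 0 0, tripleDeg d 1 1 0, tripleDeg d 1 0 1, tripleDeg d 1 1 1] := by
  unfold bresinsky
  rw [← hd]
  simp only [Nat.add_sub_cancel, tripleDeg]
  congr 1
  · ring
  congr 1
  · ring
  congr 1
  · ring
  congr 1
  ring

theorem mem_semigroupOf_bresinsky (hd : d + 1 = 2 * h) (s : ℕ) :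
    s ∈ semigroupOf (bresinsky h) ↔ HasOrder d 0 s := by
  constructor
  · intro hs
    refine AddSubmonoid.closure_induction ?_ ⟨0, 0, 0, le_rfl, le_rfl, le_rfl, by simp [tripleDeg]⟩
      (fun x y _ _ hx hy => by simpa using hx.add hy) hs
    rintro _ ⟨i, rfl⟩
    rw [bresinsky_eq hd]
    fin_cases i
    · exact ⟨1, 0, 0, by simp, by simp, by simp, rfl⟩
    · exact ⟨1, 1, 0, by simp, by simp, by simp, rfl⟩
    · exact ⟨1, 0, 1, by simp, by simp, by simp, rfl⟩
    · exact ⟨1, 1, 1, by simp, by simp, by simp, rfl⟩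
  · rintro ⟨n, u, v, hu, hv, -, rfl⟩
    induction n generalizing u v with
    | zero =>
      obtain rfl : u = 0 := by omega
      obtain rfl : v = 0 := by omega
      simp [tripleDeg]
    | succ n ih =>
      have hgen : ∀ a b, a ≤ 1 → b ≤ 1 → tripleDeg d 1 a b ∈ semigroupOf (bresinsky h) := by
        intro a b ha hb
        interval_cases a <;> interval_cases b
        · exact bresinsky_eq hd ▸ mem_semigroupOf (bresinsky h) 0
        · exact bresinsky_eq hd ▸ mem_semigroupOf (bresinsky h) 2
        · exact bresinsky_eq hd ▸ mem_semigroupOf (bresinsky h) 1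
        · exact bresinsky_eq hd ▸ mem_semigroupOf (bresinsky h) 3
      -- One generator is split off, using up one unit of u and one of v where available; this keeps
      -- u, v ≤ n.
      have := add_mem (ih (u - 1) (v - 1) (by omega) (by omega))
        (hgen (min u 1) (min v 1) (by omega) (by omega))
      rwa [tripleDeg_add, show u - 1 + min u 1 = u by omega,
        show v - 1 + min v 1 = v by omega] at this

theorem isNumericalSemigroup_bresinsky (hd : d + 1 = 2 * h) :
    IsNumericalSemigroup (semigroupOf (bresinsky h)) := by
  obtain ⟨N, hN⟩ := Nat.exists_mem_closure_of_ge (Set.range (bresinsky h))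
  have hgcd : Nat.setGcd (Set.range (bresinsky h)) = 1 := by
    have hdvd : ∀ i, Nat.setGcd (Set.range (bresinsky h)) ∣ bresinsky h i := fun i =>
      Nat.setGcd_dvd_of_mem ⟨i, rfl⟩
    generalize Nat.setGcd (Set.range (bresinsky h)) = g at hdvd
    have h0 := hdvd 0
    have h1 := hdvd 1
    have h2 := hdvd 2
    have h3 := hdvd 3
    rw [bresinsky_eq hd] at h0 h1 h2 h3
    simp only [Matrix.cons_val, tripleDeg] at h0 h1 h2 h3
    -- Differences of generators show that the gcd divides d and 2(d+1), hence d and 2, and d is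
    -- odd.
    have e1 : g ∣ d := by
      have := (Nat.dvd_add_right h0).1 (show g ∣ (d + 1) * d * 1 + d by convert h1 using 1; ring)
      exact this
    have e2 : g ∣ 2 * (d + 1) := by
      have := (Nat.dvd_add_right h0).1
        (show g ∣ (d + 1) * d * 1 + 2 * (d + 1) by convert h2 using 1; ring)
      exact this
    have e3 : g ∣ 2 := by
      have := (Nat.dvd_add_right (e1.mul_left 2)).1 (show g ∣ 2 * d + 2 from e2)
      exact this
    have hcop : Nat.gcd d 2 = 1 := by
      rw [← Nat.Coprime, Nat.coprime_two_right]
      exact ⟨h - 1, by omega⟩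
    exact Nat.dvd_one.1 (hcop ▸ Nat.dvd_gcd e1 e3)
  refine (Set.finite_lt_nat N).subset fun s hs => ?_
  by_contra hlt
  exact hs (hN s (not_lt.1 hlt) (by rw [hgcd]; exact one_dvd s))

theorem bresinsky_normalForm (hd : d + 1 = 2 * h) (hd2 : 2 ≤ d) (i : Fin 4) :
    ∃ u v, (1, u, v) ∈ normalForms d ∧ bresinsky h i = tripleDeg d 1 u v ∧ i = u + 2 * v := by
  rw [bresinsky_eq hd]
  fin_cases i
  · exact ⟨0, 0, ⟨by simp, by simp; omega, by simp, by simp⟩, rfl, rfl⟩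
  · exact ⟨1, 0, ⟨by simp; omega, by simp; omega, by simp, by simp⟩, rfl, rfl⟩
  · exact ⟨0, 1, ⟨by simp, by simp; omega, by simp, by simp⟩, rfl, rfl⟩
  · exact ⟨1, 1, ⟨by simp; omega, by simp; omega, by simp, by simp⟩, rfl, rfl⟩

/-- A generator has order exactly 1, while a sum of at least two generators has order at least 2; a
single other generator has a different normal form. -/
theorem isMinimalGenerators_bresinsky (hd : d + 1 = 2 * h) (hd2 : 2 ≤ d) :
    IsMinimalGenerators (bresinsky h) := by
  intro i hi
  obtain ⟨u, v, ht, hiuv, hi'⟩ := bresinsky_normalForm hd hd2 i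
  have key : ∀ s ∈ AddSubmonoid.closure (bresinsky h '' {i}ᶜ),
      s = 0 ∨ (∃ j, j ≠ i ∧ s = bresinsky h j) ∨ HasOrder d 2 s := by
    have horder : ∀ j, HasOrder d 1 (bresinsky h j) := by
      intro j
      obtain ⟨u, v, ht, hj, -⟩ := bresinsky_normalForm hd hd2 j
      rw [hj]
      exact (hasOrder_tripleDeg hd ht).2 le_rfl
    intro s hs
    refine AddSubmonoid.closure_induction ?_ (Or.inl rfl) ?_ hs
    · rintro _ ⟨j, hj, rfl⟩
      exact Or.inr (Or.inl ⟨j, hj, rfl⟩)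
    · rintro x y - - (rfl | ⟨j, hj, rfl⟩ | hx) (rfl | ⟨k, hk, rfl⟩ | hy)
      · simp
      · simpa using Or.inr (Or.inl ⟨k, hk, rfl⟩)
      · simp [hy]
      · simpa using Or.inr (Or.inl ⟨j, hj, rfl⟩)
      · exact Or.inr (Or.inr ((horder j).add (horder k)))
      · exact Or.inr (Or.inr (((horder j).add hy).mono (by omega)))
      · simp [hx]
      · exact Or.inr (Or.inr ((hx.add (horder k)).mono (by omega)))
      · exact Or.inr (Or.inr ((hx.add hy).mono (by omega)))
  rcases key _ hi with h0 | ⟨j, hj, hij⟩ | h2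
  · have : 0 < tripleDeg d 1 u v := by
      unfold tripleDeg
      have : 0 < (d + 1) * d * 1 := by positivity
      omega
    omega
  · obtain ⟨u', v', ht', hj', hj''⟩ := bresinsky_normalForm hd hd2 j
    obtain ⟨-, rfl, rfl⟩ := tripleDeg_injOn hd ht.1 ht.2.1 ht'.1 ht'.2.1
      (hiuv.symm.trans (hij.trans hj'))
    exact hj (Fin.ext (hj''.trans hi'.symm))
  · rw [hiuv, hasOrder_tripleDeg hd ht] at h2
    omega

end Bresinsky

end

noncomputable section

/-! ### Monomials in semigroup rings -/

namespace SemigroupRing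

variable (K : Type u) [Field K] {H : AddSubmonoid ℕ}

variable (H) in
/-- The monomial `t^s` of `K[H]`, which is zero if `s ∉ H`. -/
def mono (s : ℕ) : SemigroupRing K H :=
  open Classical in if hs : s ∈ H then monomial K s hs else 0

variable {K}

theorem mono_eq {s : ℕ} (hs : s ∈ H) : mono K H s = monomial K s hs := dif_pos hs

theorem coe_mono {s : ℕ} (hs : s ∈ H) : (mono K H s : Polynomial K) = Polynomial.X ^ s := by
  rw [mono_eq hs]
  rfl

theorem mono_mul_mono {s t : ℕ} (hs : s ∈ H) (ht : t ∈ H) :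
    mono K H s * mono K H t = mono K H (s + t) := by
  refine Subtype.ext ?_
  change (mono K H s : Polynomial K) * (mono K H t : Polynomial K) = _
  rw [coe_mono hs, coe_mono ht, coe_mono (add_mem hs ht), pow_add]

theorem mem_of_coeff_ne_zero (f : SemigroupRing K H) {s : ℕ}
    (hs : (f : Polynomial K).coeff s ≠ 0) : s ∈ H := by
  obtain ⟨f, hf⟩ := f
  simp only at hs
  induction hf using Algebra.adjoin_induction generalizing s with
  | mem x hx =>
    obtain ⟨t, ht, rfl⟩ := hx
    rw [Polynomial.coeff_X_pow] at hs
    split_ifs at hs with h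
    · exact h ▸ ht
    · exact absurd rfl hs
  | algebraMap r =>
    rw [Polynomial.algebraMap_apply, Polynomial.coeff_C] at hs
    split_ifs at hs with h
    · exact h ▸ H.zero_mem
    · exact absurd rfl hs
  | add x y _ _ hx hy =>
    rw [Polynomial.coeff_add] at hs
    by_cases h : x.coeff s = 0
    · exact hy (by simpa [h] using hs)
    · exact hx h
  | mul x y _ _ hx hy =>
    rw [Polynomial.coeff_mul] at hs
    obtain ⟨p, hp, hne⟩ := Finset.exists_ne_zero_of_sum_ne_zero hs
    rw [← Finset.HasAntidiagonal.mem_antidiagonal.1 hp]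
    exact add_mem (hx (left_ne_zero_of_mul hne)) (hy (right_ne_zero_of_mul hne))

theorem sum_coeff_smul_mono (f : SemigroupRing K H) :
    ∑ s ∈ (f : Polynomial K).support, (f : Polynomial K).coeff s • mono K H s = f := by
  refine Subtype.ext ?_
  rw [AddSubmonoidClass.coe_finsetSum]
  conv_rhs => rw [(f : Polynomial K).as_sum_support]
  refine Finset.sum_congr rfl fun s hs => ?_
  change (f : Polynomial K).coeff s • (mono K H s : Polynomial K) = _
  rw [coe_mono (mem_of_coeff_ne_zero f (Polynomial.mem_support_iff.1 hs)), Polynomial.smul_X_eq_monomial]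

end SemigroupRing

section Bresinsky

open SemigroupRing MvPolynomial

variable (K : Type u) [Field K] {d h : ℕ}

theorem tripleDeg_mem (hd : d + 1 = 2 * h) {n u v : ℕ} (hu : u ≤ n) (hv : v ≤ n) :
    tripleDeg d n u v ∈ semigroupOf (bresinsky h) :=
  (mem_semigroupOf_bresinsky hd _).2 ⟨n, u, v, hu, hv, n.zero_le, rfl⟩

/-- The monomial of degree `tripleDeg d n u v` of the Bresinsky semigroup ring. -/
def tripleMono (d h : ℕ) (n u v : ℕ) : SemigroupRing K (semigroupOf (bresinsky h)) :=
  mono K _ (tripleDeg d n u v)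

variable {K}

theorem coe_tripleMono (hd : d + 1 = 2 * h) {n u v : ℕ} (hu : u ≤ n) (hv : v ≤ n) :
    (tripleMono K d h n u v : Polynomial K) = Polynomial.X ^ tripleDeg d n u v :=
  coe_mono (tripleDeg_mem hd hu hv)

theorem tripleMono_mul (hd : d + 1 = 2 * h) {n u v n' u' v' : ℕ} (hu : u ≤ n) (hv : v ≤ n)
    (hu' : u' ≤ n') (hv' : v' ≤ n') :
    tripleMono K d h n u v * tripleMono K d h n' u' v' =
      tripleMono K d h (n + n') (u + u') (v + v') := by
  rw [tripleMono, tripleMono, mono_mul_mono (tripleDeg_mem hd hu hv) (tripleDeg_mem hd hu' hv'),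
    tripleDeg_add]
  rfl

theorem tripleMono_left_wrap (n v : ℕ) :
    tripleMono K d h n (d + 1) v = tripleMono K d h (n + 1) 0 v := by
  unfold tripleMono
  rw [← tripleDeg_left_wrap, zero_add]

theorem tripleMono_right_wrap (n u : ℕ) :
    tripleMono K d h n u d = tripleMono K d h (n + 2) u 0 := by
  unfold tripleMono
  rw [← tripleDeg_right_wrap, zero_add]

theorem gen_eq_tripleMono (hd : d + 1 = 2 * h) :
    SemigroupRing.gen K (bresinsky h) =
      ![tripleMono K d h 1 0 0, tripleMono K d h 1 1 0, tripleMono K d h 1 0 1,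
        tripleMono K d h 1 1 1] := by
  funext i
  have h1 : SemigroupRing.gen K (bresinsky h) i = mono K _ (bresinsky h i) :=
    (mono_eq (mem_semigroupOf _ i)).symm
  refine h1.trans ((congrArg (mono K _) (congrFun (bresinsky_eq hd) i)).trans ?_)
  fin_cases i <;> rfl

theorem linearIndependent_tripleMono (hd : d + 1 = 2 * h) :
    LinearIndependent K fun t : normalForms d => tripleMono K d h t.1.1 t.1.2.1 t.1.2.2 := by
  refine LinearIndependent.of_comp (Subalgebra.val _).toLinearMap ?_
  have h1 := (Polynomial.basisMonomials K).linearIndependent.comp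
    (fun t : normalForms d => tripleDeg d t.1.1 t.1.2.1 t.1.2.2) (by
      rintro ⟨⟨n, u, v⟩, ht⟩ ⟨⟨n', u', v'⟩, ht'⟩ heq
      obtain ⟨rfl, rfl, rfl⟩ := tripleDeg_injOn hd ht.1 ht.2.1 ht'.1 ht'.2.1 heq
      rfl)
  have h2 : (Subalgebra.val _).toLinearMap ∘
      (fun t : normalForms d => tripleMono K d h t.1.1 t.1.2.1 t.1.2.2) =
      Polynomial.basisMonomials K ∘ fun t => tripleDeg d t.1.1 t.1.2.1 t.1.2.2 := by
    ext1 t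
    refine (coe_tripleMono hd t.2.2.2.1 t.2.2.2.2).trans ?_
    simp [Polynomial.X_pow_eq_monomial]
  rw [h2]
  exact h1

theorem mono_mem_span (hd : d + 1 = 2 * h) {s : ℕ} (hs : s ∈ semigroupOf (bresinsky h)) :
    mono K _ s ∈ Submodule.span K (Set.range fun t : normalForms d =>
      tripleMono K d h t.1.1 t.1.2.1 t.1.2.2) := by
  obtain ⟨n, u, v, h1, h2, -, rfl⟩ := (mem_semigroupOf_bresinsky hd s).1 hs
  obtain ⟨n', u', v', h3, -, h4⟩ := exists_normalForm (d := d) (by omega) n u v h1 h2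
  rw [← h4]
  exact Submodule.subset_span ⟨⟨_, h3⟩, rfl⟩

/-- The basis of the Bresinsky semigroup ring indexed by normal forms. -/
def semigroupRingBasis (K : Type u) [Field K] (hd : d + 1 = 2 * h) :
    Module.Basis (normalForms d) K (SemigroupRing K (semigroupOf (bresinsky h))) :=
  Module.Basis.mk (linearIndependent_tripleMono hd) fun f _ => by
    rw [← sum_coeff_smul_mono f]
    exact Submodule.sum_mem _ fun s hs => Submodule.smul_mem _ _
      (mono_mem_span hd (mem_of_coeff_ne_zero f (Polynomial.mem_support_iff.1 hs)))

/-- Products inside the range are immediate. When u reaches d+1 or v reaches d, the trade raises n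
once more, leaving a spare factor x₀. -/
theorem isMonomialBasis_semigroupRing (hd : d + 1 = 2 * h) :
    IsMonomialBasis d (toSemigroupRing K (bresinsky h))
      (fun t => tripleMono K d h t.1 t.2.1 t.2.2) (semigroupRingBasis K hd) := by
  have hX : ∀ i, toSemigroupRing K (bresinsky h) (X i) = _ := fun i =>
    (eval₂Hom_X' _ _ i).trans (congrFun (gen_eq_tripleMono hd) i)
  have h0 : toSemigroupRing K (bresinsky h) (X 0) = tripleMono K d h 1 0 0 := hX 0
  have h1 : toSemigroupRing K (bresinsky h) (X 1) = tripleMono K d h 1 1 0 := hX 1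
  have h2 : toSemigroupRing K (bresinsky h) (X 2) = tripleMono K d h 1 0 1 := hX 2
  have h3 : toSemigroupRing K (bresinsky h) (X 3) = tripleMono K d h 1 1 1 := hX 3
  have hdvd : ∀ n u v, u ≤ n → v ≤ n →
      tripleMono K d h 1 0 0 ∣ tripleMono K d h (n + 1) u v := by
    intro n u v hu hv
    refine ⟨tripleMono K d h n u v, ?_⟩
    rw [tripleMono_mul hd (by omega) (by omega) hu hv, zero_add, zero_add, add_comm 1 n]
  have hmul : ∀ n u v a b, (n, u, v) ∈ normalForms d → a ≤ 1 → b ≤ 1 →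
      tripleMono K d h 1 a b * tripleMono K d h n u v =
        tripleMono K d h (n + 1) (u + a) (v + b) := by
    intro n u v a b ht ha hb
    rw [tripleMono_mul hd ha hb ht.2.2.1 ht.2.2.2, add_comm 1 n, add_comm a u, add_comm b v]
  refine ⟨?_, ?_, ?_, ?_, ?_, ?_, ?_, ?_, ?_⟩
  · intro r a
    rw [Algebra.smul_def]
    exact congrArg (· * a) (eval₂Hom_C _ _ r).symm
  · intro t
    exact Module.Basis.mk_apply _ _ _
  · intro n u v ht
    simp only [h0]
    exact hmul n u v 0 0 ht (by omega) (by omega)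
  · intro n u v ht hu
    simp only [h1]
    exact hmul n u v 1 0 ht (by omega) (by omega)
  · rintro n u v ht rfl
    simp only [h0, h1]
    rw [hmul _ _ _ _ _ ht (by omega) (by omega), tripleMono_left_wrap]
    exact hdvd _ _ _ (by omega) (ht.2.2.2.trans n.le_succ)
  · intro n u v ht hv
    simp only [h2]
    exact hmul n u v 0 1 ht (by omega) (by omega)
  · rintro n u v ht rfl
    simp only [h0, h2]
    rw [hmul _ _ _ _ _ ht (by omega) (by omega), tripleMono_right_wrap]
    exact hdvd _ _ _ (ht.2.2.1.trans (by simp only; omega)) (by omega)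
  · intro n u v ht hu hv
    simp only [h3]
    exact hmul n u v 1 1 ht (by omega) (by omega)
  · rintro n u v ht huv
    have h5 := ht.2.2.1
    have h6 := ht.2.2.2
    simp only at h5 h6
    simp only [h0, h3]
    rw [hmul _ _ _ _ _ ht (by omega) (by omega)]
    rcases huv with rfl | rfl
    · rw [tripleMono_left_wrap]
      exact hdvd _ _ _ (by omega) (by omega)
    · rw [tripleMono_right_wrap]
      exact hdvd _ _ _ (by omega) (by omega)

end Bresinsky

end

noncomputable section

/-! ### The tangent cone of the Bresinsky semigroup ring -/

section TangentCone

open SemigroupRing MvPolynomial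

variable {K : Type u} [Field K] {d h : ℕ}

theorem hasOrder_one_of_ne_zero {s : ℕ} (hs : HasOrder d 0 s) (h0 : s ≠ 0) : HasOrder d 1 s := by
  obtain ⟨n, u, v, hu, hv, -, rfl⟩ := hs
  refine ⟨n, u, v, hu, hv, ?_, rfl⟩
  by_contra hn
  obtain rfl : n = 0 := by omega
  obtain rfl : u = 0 := by omega
  obtain rfl : v = 0 := by omega
  exact h0 (by simp [tripleDeg])

theorem hasOrder_of_mul {i j : ℕ} {f g : Polynomial K} (hf : ∀ s, f.coeff s ≠ 0 → HasOrder d i s)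
    (hg : ∀ s, g.coeff s ≠ 0 → HasOrder d j s) (s : ℕ) (hs : (f * g).coeff s ≠ 0) :
    HasOrder d (i + j) s := by
  rw [Polynomial.coeff_mul] at hs
  obtain ⟨p, hp, hne⟩ := Finset.exists_ne_zero_of_sum_ne_zero hs
  rw [← Finset.HasAntidiagonal.mem_antidiagonal.1 hp]
  exact (hf _ (left_ne_zero_of_mul hne)).add (hg _ (right_ne_zero_of_mul hne))

theorem hasOrder_of_add {i : ℕ} {f g : Polynomial K} (hf : ∀ s, f.coeff s ≠ 0 → HasOrder d i s)
    (hg : ∀ s, g.coeff s ≠ 0 → HasOrder d i s) (s : ℕ) (hs : (f + g).coeff s ≠ 0) :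
    HasOrder d i s := by
  rw [Polynomial.coeff_add] at hs
  by_cases h0 : f.coeff s = 0
  · exact hg s (by simpa [h0] using hs)
  · exact hf s h0

/-- Together with `mono_mem_pow` this says that 𝔪^i is spanned by the monomials of order at least i.
-/
theorem hasOrder_of_mem_pow (hd : d + 1 = 2 * h) (i : ℕ)
    {f : SemigroupRing K (semigroupOf (bresinsky h))}
    (hf : f ∈ maxIdeal K (semigroupOf (bresinsky h)) ^ i) (s : ℕ)
    (hs : (f : Polynomial K).coeff s ≠ 0) : HasOrder d i s := by
  have hzero : ∀ (f : SemigroupRing K (semigroupOf (bresinsky h))) (s : ℕ),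
      (f : Polynomial K).coeff s ≠ 0 → HasOrder d 0 s := fun f s hs =>
    (mem_semigroupOf_bresinsky hd s).1 (mem_of_coeff_ne_zero f hs)
  have hone : ∀ f ∈ maxIdeal K (semigroupOf (bresinsky h)), ∀ s,
      (f : Polynomial K).coeff s ≠ 0 → HasOrder d 1 s := by
    intro f hf
    refine Submodule.span_induction ?_ ?_ ?_ ?_ hf
    · rintro _ ⟨t, ht, h0, rfl⟩ s hs
      have hs : (Polynomial.X ^ t : Polynomial K).coeff s ≠ 0 := hs
      rw [Polynomial.coeff_X_pow] at hs
      split_ifs at hs with hst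
      · rw [hst]
        exact hasOrder_one_of_ne_zero ((mem_semigroupOf_bresinsky hd t).1 ht) h0
      · exact absurd rfl hs
    · intro s hs
      exact absurd (Polynomial.coeff_zero s) hs
    · intro x y _ _ hx hy
      exact hasOrder_of_add hx hy
    · intro r x _ hx s hs
      simpa using hasOrder_of_mul (hzero r) hx s hs
  induction i generalizing f s with
  | zero => exact hzero f s hs
  | succ i ih =>
    rw [pow_succ] at hf
    revert s
    refine Submodule.mul_induction_on hf ?_ ?_
    · intro a ha b hb
      exact hasOrder_of_mul (fun s => ih ha s) (hone b hb)
    · intro x y hx hy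
      exact hasOrder_of_add hx hy

theorem tripleMono_mem_pow (hd : d + 1 = 2 * h) (n u v : ℕ) (hu : u ≤ n) (hv : v ≤ n) :
    tripleMono K d h n u v ∈ maxIdeal K (semigroupOf (bresinsky h)) ^ n := by
  induction n generalizing u v with
  | zero => simp
  | succ n ih =>
    have h1 : tripleMono K d h 1 (min u 1) (min v 1) ∈ maxIdeal K (semigroupOf (bresinsky h)) := by
      have hmem := tripleDeg_mem hd (min_le_right u 1) (min_le_right v 1)
      refine Ideal.subset_span ⟨_, hmem, ?_, mono_eq hmem⟩
      have : 0 < (d + 1) * d * 1 := Nat.mul_pos (Nat.mul_pos (by omega) (by omega)) one_pos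
      unfold tripleDeg
      omega
    have h2 := Ideal.mul_mem_mul (ih (u - 1) (v - 1) (by omega) (by omega)) h1
    rwa [← pow_succ, tripleMono_mul hd (by omega) (by omega) (by omega) (by omega),
      show u - 1 + min u 1 = u by omega, show v - 1 + min v 1 = v by omega] at h2

theorem mono_mem_pow (hd : d + 1 = 2 * h) {i s : ℕ} (hs : HasOrder d i s) :
    mono K (semigroupOf (bresinsky h)) s ∈ maxIdeal K (semigroupOf (bresinsky h)) ^ i := by
  obtain ⟨n, u, v, hu, hv, hi, rfl⟩ := hs
  exact Ideal.pow_le_pow_right hi (tripleMono_mem_pow hd n u v hu hv)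

end TangentCone

/-! ### Classes and functionals on an associated graded ring -/

namespace AssociatedGraded

variable {R : Type u} [CommRing R] (I : Ideal R)

theorem of_congr {i j : ℕ} (hij : i = j) {x y : R} (hxy : x = y) (hx : x ∈ I ^ i) (hy : y ∈ I ^ j) :
    of I i x hx = of I j y hy := by
  subst hij hxy
  rfl

theorem of_eq_zero {i : ℕ} {x : R} (hx : x ∈ I ^ i) (hx' : x ∈ I ^ (i + 1)) : of I i x hx = 0 := by
  rw [of, (GradedPiece.mk_eq_zero_iff I _).2 hx', map_zero]

/-- The class in `I^i / I^(i+1)` as an additive map. -/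
def ofHom (i : ℕ) : ↥(I ^ i) →+ AssociatedGraded I :=
  (DirectSum.of (GradedPiece I) i).comp (GradedPiece.mk I i).toAddMonoidHom

theorem ofHom_apply {i : ℕ} (x : ↥(I ^ i)) : ofHom I i x = of I i x x.2 := rfl

theorem ofZero_mul_of (r : R) {i : ℕ} {x : R} (hx : x ∈ I ^ i) :
    ofZero I r * of I i x hx = of I i (r * x) (Ideal.mul_mem_left _ _ hx) :=
  (of_mul_of I 0 i r x _ hx).trans (of_congr I (zero_add i) rfl _ _)

/-- An additive functional on `I^i` that vanishes on `I^(i+1)` extends to the associated graded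
ring. -/
theorem exists_functional {M : Type*} [AddCommGroup M] (i : ℕ) (l : R →+ M)
    (hl : ∀ x ∈ I ^ (i + 1), l x = 0) :
    ∃ L : AssociatedGraded I →+ M, ∀ j x (hx : x ∈ I ^ j),
      L (of I j x hx) = if j = i then l x else 0 := by
  let q : GradedPiece I i →+ M := QuotientAddGroup.lift _
    (l.comp (Submodule.subtype (I ^ i)).toAddMonoidHom) (fun x hx => hl _ hx)
  refine ⟨DirectSum.toAddMonoid fun j => if hj : j = i then hj ▸ q else 0, fun j x hx => ?_⟩
  rw [of, DirectSum.toAddMonoid_of]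
  split_ifs with hj
  · subst hj
    rfl
  · rfl

end AssociatedGraded

/-! ### The monomial basis of the tangent cone -/

section TangentCone

open SemigroupRing MvPolynomial AssociatedGraded

variable {K : Type u} [Field K] {d h : ℕ}

/-- The class of the monomial of degree `tripleDeg d n u v` in the `n`-th graded piece of the
tangent cone of the Bresinsky semigroup ring. -/
def tripleClass (K : Type u) [Field K] (d h n u v : ℕ) :
    TangentCone K (semigroupOf (bresinsky h)) :=
  open Classical in
  if hm : tripleMono K d h n u v ∈ maxIdeal K (semigroupOf (bresinsky h)) ^ n then
    of _ n (tripleMono K d h n u v) hm else 0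

theorem tripleClass_eq (hd : d + 1 = 2 * h) {n u v : ℕ} (hu : u ≤ n) (hv : v ≤ n) :
    tripleClass K d h n u v = of _ n (tripleMono K d h n u v)
      (tripleMono_mem_pow hd n u v hu hv) :=
  dif_pos _

theorem tripleClass_mul (hd : d + 1 = 2 * h) {n u v n' u' v' : ℕ} (hu : u ≤ n) (hv : v ≤ n)
    (hu' : u' ≤ n') (hv' : v' ≤ n') :
    tripleClass K d h n u v * tripleClass K d h n' u' v' =
      tripleClass K d h (n + n') (u + u') (v + v') := by
  rw [tripleClass_eq hd hu hv, tripleClass_eq hd hu' hv', of_mul_of,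
    tripleClass_eq hd (by omega) (by omega)]
  exact of_congr _ rfl (tripleMono_mul hd hu hv hu' hv') _ _

/-- A monomial that also has a longer representation lies in a higher power of 𝔪, so its class in
degree n vanishes. -/
theorem tripleClass_eq_zero (hd : d + 1 = 2 * h) {n u v n' u' v' : ℕ} (hu : u ≤ n) (hv : v ≤ n)
    (hu' : u' ≤ n') (hv' : v' ≤ n') (hn : n < n')
    (heq : tripleMono K d h n u v = tripleMono K d h n' u' v') :
    tripleClass K d h n u v = 0 := by
  rw [tripleClass_eq hd hu hv]
  refine of_eq_zero _ _ ?_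
  rw [heq]
  exact Ideal.pow_le_pow_right hn (tripleMono_mem_pow hd n' u' v' hu' hv')

/-- The `K`-module structure of the tangent cone. -/
abbrev tangentConeModule (K : Type u) [Field K] (h : ℕ) (hh : 2 ≤ h) :
    Module K (TangentCone K (semigroupOf (bresinsky h))) :=
  Module.compHom _ ((toTangentCone K (bresinsky h) (bresinsky_ne_zero hh)).comp C)

theorem tangentCone_smul_of (hh : 2 ≤ h) (r : K) {i : ℕ}
    {x : SemigroupRing K (semigroupOf (bresinsky h))} (hx : x ∈ maxIdeal K _ ^ i) :
    letI := tangentConeModule K h hh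
    r • of _ i x hx = of _ i (algebraMap K _ r * x) (Ideal.mul_mem_left _ _ hx) := by
  letI := tangentConeModule K h hh
  refine Eq.trans ?_ (ofZero_mul_of _ (algebraMap K _ r) hx)
  exact congrArg (· * of _ i x hx) (eval₂Hom_C _ _ r)

theorem linearIndependent_tripleClass (hh : 2 ≤ h) (hd : d + 1 = 2 * h) :
    letI := tangentConeModule K h hh
    LinearIndependent K fun t : normalForms d => tripleClass K d h t.1.1 t.1.2.1 t.1.2.2 := by
  letI := tangentConeModule K h hh
  rw [linearIndependent_iff']
  rintro S g hg ⟨⟨n, u, v⟩, ht⟩ htS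
  -- The coefficient at a normal form with first entry n kills 𝔪^(n+1), since that degree has order
  -- exactly n; it therefore descends to the n-th graded piece and isolates one coefficient of the
  -- relation.
  let l : SemigroupRing K (semigroupOf (bresinsky h)) →+ K :=
    (Polynomial.lcoeff K (tripleDeg d n u v)).toAddMonoidHom.comp
      (Subalgebra.val _).toLinearMap.toAddMonoidHom
  obtain ⟨L, hL⟩ := exists_functional (maxIdeal K (semigroupOf (bresinsky h))) n l (by
    intro x hx
    by_contra hne
    have := (hasOrder_tripleDeg hd ht).1 (hasOrder_of_mem_pow hd _ hx _ hne)
    omega)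
  have h1 := congrArg L hg
  rw [map_sum, map_zero, Finset.sum_eq_single ⟨(n, u, v), ht⟩] at h1
  · rw [tripleClass_eq hd ht.2.2.1 ht.2.2.2, tangentCone_smul_of, hL, if_pos rfl] at h1
    rw [← h1]
    change _ = (algebraMap K (Polynomial K) (g _) * (tripleMono K d h n u v : Polynomial K)).coeff _
    rw [coe_tripleMono hd ht.2.2.1 ht.2.2.2]
    simp [Polynomial.coeff_C_mul]
  · rintro ⟨⟨n', u', v'⟩, ht'⟩ - hne
    rw [tripleClass_eq hd ht'.2.2.1 ht'.2.2.2, tangentCone_smul_of, hL]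
    refine ite_eq_right_iff.2 fun _ => ?_
    change (algebraMap K (Polynomial K) (g _) * (tripleMono K d h n' u' v' : Polynomial K)).coeff
      (tripleDeg d n u v) = 0
    rw [coe_tripleMono hd ht'.2.2.1 ht'.2.2.2]
    have : tripleDeg d n u v ≠ tripleDeg d n' u' v' := by
      intro heq
      obtain ⟨rfl, rfl, rfl⟩ := tripleDeg_injOn hd ht.1 ht.2.1 ht'.1 ht'.2.1 heq
      exact hne rfl
    simp [Polynomial.coeff_C_mul, Polynomial.coeff_X_pow, this]
  · intro hS
    exact absurd htS hS

theorem span_tripleClass (hh : 2 ≤ h) (hd : d + 1 = 2 * h) :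
    letI := tangentConeModule K h hh
    ⊤ ≤ Submodule.span K
      (Set.range fun t : normalForms d => tripleClass K d h t.1.1 t.1.2.1 t.1.2.2) := by
  letI := tangentConeModule K h hh
  intro x _
  induction x using DirectSum.induction_on with
  | zero => exact Submodule.zero_mem _
  | add x y hx hy => exact Submodule.add_mem _ (hx trivial) (hy trivial)
  | of i x =>
    obtain ⟨⟨f, hf⟩, rfl⟩ := GradedPiece.mk_surjective _ i x
    have hord : ∀ s : ↥(f : Polynomial K).support, HasOrder d i s := fun s =>
      hasOrder_of_mem_pow hd i hf s (Polynomial.mem_support_iff.1 s.2)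
    have hsum : (⟨f, hf⟩ : ↥(maxIdeal K (semigroupOf (bresinsky h)) ^ i)) =
        ∑ s : ↥(f : Polynomial K).support,
          ⟨algebraMap K _ ((f : Polynomial K).coeff s) * mono K _ (s : ℕ),
            Ideal.mul_mem_left _ _ (mono_mem_pow hd (hord s))⟩ := by
      refine Subtype.ext ?_
      rw [AddSubmonoidClass.coe_finsetSum]
      simp only [← Algebra.smul_def]
      rw [Finset.sum_coe_sort (f : Polynomial K).support
        (fun s => (f : Polynomial K).coeff s • mono K (semigroupOf (bresinsky h)) s),
        sum_coeff_smul_mono]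
    change ofHom _ i _ ∈ _
    rw [hsum, map_sum]
    refine Submodule.sum_mem _ fun s _ => ?_
    rw [ofHom_apply]
    have hs := tangentCone_smul_of hh ((f : Polynomial K).coeff s) (mono_mem_pow (K := K) hd (hord s))
    refine hs ▸ Submodule.smul_mem _ _ ?_
    obtain ⟨n, u, v, hu, hv, hi, hs⟩ := hord s
    obtain ⟨n', u', v', h3, h4, h5⟩ := exists_normalForm (d := d) (by omega) n u v hu hv
    have heq : mono K (semigroupOf (bresinsky h)) (s : ℕ) = tripleMono K d h n' u' v' := by
      rw [tripleMono, h5, hs]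
    -- A monomial of order exactly i gives a basis class in degree i; one of higher order lies in
    -- 𝔪^(i+1) and gives zero.
    rcases (hi.trans h4).eq_or_lt with rfl | hlt
    · refine Submodule.subset_span ⟨⟨_, h3⟩, ?_⟩
      refine (tripleClass_eq hd h3.2.2.1 h3.2.2.2).trans ?_
      exact of_congr _ rfl heq.symm _ _
    · rw [of_eq_zero]
      · exact Submodule.zero_mem _
      · rw [heq]
        exact Ideal.pow_le_pow_right hlt (tripleMono_mem_pow hd _ _ _ h3.2.2.1 h3.2.2.2)

/-- The same multiplication table as for K[B_h], except that a product leaving the range has order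
above its degree and is zero, which x₀ divides trivially. -/
theorem isMonomialBasis_tangentCone (hh : 2 ≤ h) (hd : d + 1 = 2 * h) :
    letI := tangentConeModule K h hh
    IsMonomialBasis d (toTangentCone K (bresinsky h) (bresinsky_ne_zero hh))
      (fun t => tripleClass K d h t.1 t.2.1 t.2.2)
      (Module.Basis.mk (linearIndependent_tripleClass (K := K) hh hd) (span_tripleClass hh hd)) := by
  letI := tangentConeModule K h hh
  have hX : ∀ i, toTangentCone K (bresinsky h) (bresinsky_ne_zero hh) (X i) =
      of _ 1 (SemigroupRing.gen K (bresinsky h) i)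
        (SemigroupRing.gen_mem K _ i (bresinsky_ne_zero hh i)) := fun i => eval₂Hom_X' _ _ i
  have hX' : ∀ i u v, u ≤ 1 → v ≤ 1 →
      SemigroupRing.gen K (bresinsky h) i = tripleMono K d h 1 u v →
      toTangentCone K (bresinsky h) (bresinsky_ne_zero hh) (X i) = tripleClass K d h 1 u v := by
    intro i u v hu hv hi
    rw [hX, tripleClass_eq hd hu hv]
    exact of_congr _ rfl hi _ _
  have h0 := hX' 0 0 0 (by omega) (by omega) (congrFun (gen_eq_tripleMono hd) 0)
  have h1 := hX' 1 1 0 (by omega) (by omega) (congrFun (gen_eq_tripleMono hd) 1)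
  have h2 := hX' 2 0 1 (by omega) (by omega) (congrFun (gen_eq_tripleMono hd) 2)
  have h3 := hX' 3 1 1 (by omega) (by omega) (congrFun (gen_eq_tripleMono hd) 3)
  have hmul : ∀ n u v a b, (n, u, v) ∈ normalForms d → a ≤ 1 → b ≤ 1 →
      tripleClass K d h 1 a b * tripleClass K d h n u v =
        tripleClass K d h (n + 1) (u + a) (v + b) := by
    intro n u v a b ht ha hb
    rw [tripleClass_mul hd ha hb ht.2.2.1 ht.2.2.2, add_comm 1 n, add_comm a u, add_comm b v]
  refine ⟨?_, ?_, ?_, ?_, ?_, ?_, ?_, ?_, ?_⟩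
  · intro r a
    rfl
  · intro t
    exact Module.Basis.mk_apply _ _ _
  · intro n u v ht
    simp only [h0]
    exact hmul n u v 0 0 ht (by omega) (by omega)
  · intro n u v ht hu
    simp only [h1]
    exact hmul n u v 1 0 ht (by omega) (by omega)
  · rintro n u v ht rfl
    have h5 := ht.2.2.1
    have h6 := ht.2.2.2
    simp only at h5 h6
    simp only [h1]
    rw [hmul _ _ _ _ _ ht (by omega) (by omega), tripleClass_eq_zero hd (by omega) (by omega)
      (by omega) (by omega) (Nat.lt_succ_self _) (tripleMono_left_wrap _ _)]
    exact dvd_zero _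
  · intro n u v ht hv
    simp only [h2]
    exact hmul n u v 0 1 ht (by omega) (by omega)
  · rintro n u v ht rfl
    have h5 := ht.2.2.1
    have h6 := ht.2.2.2
    simp only at h5 h6
    simp only [h2]
    rw [hmul _ _ _ _ _ ht (by omega) (by omega), tripleClass_eq_zero hd (by omega) (by omega)
      (by omega) (by omega) (Nat.lt_add_of_pos_right two_pos) (tripleMono_right_wrap _ _)]
    exact dvd_zero _
  · intro n u v ht hu hv
    simp only [h3]
    exact hmul n u v 1 1 ht (by omega) (by omega)
  · rintro n u v ht huv
    have h5 := ht.2.2.1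
    have h6 := ht.2.2.2
    simp only at h5 h6
    simp only [h3]
    rw [hmul _ _ _ _ _ ht (by omega) (by omega)]
    rcases huv with rfl | rfl
    · rw [tripleClass_eq_zero hd (by omega) (by omega)
        (by omega) (by omega) (Nat.lt_succ_self _) (tripleMono_left_wrap _ _)]
      exact dvd_zero _
    · rw [tripleClass_eq_zero hd (by omega) (by omega)
        (by omega) (by omega) (Nat.lt_add_of_pos_right two_pos) (tripleMono_right_wrap _ _)]
      exact dvd_zero _

end TangentCone

end

theorem theorem7p1 (K : Type u) [Field K] (h : ℕ) (hh : 2 ≤ h) :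
    IsNumericalSemigroup (semigroupOf (bresinsky h)) ∧
    IsMinimalGenerators (bresinsky h) ∧
    HasBettiSequence K (toSemigroupRing K (bresinsky h)) [1, 4 * h, 8 * h - 4, 4 * h - 3] ∧
    HasBettiSequence K (toTangentCone K (bresinsky h) (bresinsky_ne_zero hh))
      [1, 4 * h, 8 * h - 4, 4 * h - 3] := by
  have hd : (2 * h - 1) + 1 = 2 * h := by omega
  have hl : [1, 4 * h, 8 * h - 4, 4 * h - 3] =
      [1, 2 * (2 * h - 1) + 2, 4 * (2 * h - 1), 2 * (2 * h - 1) - 1] := by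
    congr 1
    congr 1
    · omega
    congr 1
    · omega
    congr 1
    omega
  rw [hl]
  letI := tangentConeModule K h hh
  exact ⟨isNumericalSemigroup_bresinsky hd, isMinimalGenerators_bresinsky hd (by omega),
    (isMonomialBasis_semigroupRing hd).hasBettiSequence (by omega),
    (isMonomialBasis_tangentCone hh hd).hasBettiSequence (by omega)⟩
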